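/- Let $\Omega=(0,L)\times(0,L)$ with $L>0$. For an integer $m\ge 0$ let $H^m(\Omega)$ be the Sobolev space of real- (or complex-) valued $u\in L^2(\Omega)$ whose weak derivatives $D^\alpha u$, $|\alpha|\le m$, belong to $L^2(\Omega)$, with norm $\|u\|_{H^m}=\big(\sum_{|\alpha|\le m}\|D^\alpha u\|_{L^2}^2\big)^{1/2}$. Let the periodic Sobolev space $H_P^m(\Omega)$, normed by $\|\cdot\|_{H^m}$, consist of those $u\in H^m(\Omega)$ such that for every $k=0,\dots,m-1$ the boundary trace of $\partial_x^k u$ takes the same values a.e. on the sides $x=0$ and $x=L$, and the boundary trace of $\partial_y^k u$ takes the same values a.e. on the sides $y=0$ and $y=L$; in particular $H_P^0(\Omega)=L^2(\Omega)$. **Theorem.** For every integer $m\ge 0$ there is a constant $C_E>0$ depending only on $m$ (in particular not on $L$) such that for each $w\in H_P^m(\Omega)$ there is a unique $u=\mathcal E(w)\in H_P^{m+2}(\Omega)$ with $$-\Delta u+u=w\quad\text{a.e. on }\Omega,$$ and this $u$ satisfies $$\|u\|_{H^{m+2}}\le C_E\,\|w\|_{H^m}.$$ Moreover, the temporal regularity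 of $w$ carries over to $u$: let $T>0$ and let $w:[0,T]\to H_P^m(\Omega)$, $u(t)=\mathcal E(w(t))\in H_P^{m+2}(\Omega)$. 1. If $w\in C^n([0,T],H_P^m(\Omega))$ with $0\le n\le\infty$, then $u\in C^n([0,T],H_P^{m+2}(\Omega))$. 2. If $w\in L^p(0,T;H_P^m(\Omega))$ with $1\le p\le\infty$, then $u\in L^p(0,T;H_P^{m+2}(\Omega))$. 3. If $1\le p\le\infty$ and $w\in L^p(0,T;H_P^m(\Omega))$ has a weak time derivative $w_t\in L^p(0,T;H_P^m(\Omega))$, then $u$ has the weak time derivative $u_t=\mathcal E(w_t)\in L^p(0,T;H_P^{m+2}(\Omega))$. -/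

import Mathlib

open MeasureTheory Set Filter Topology
open scoped ENNReal ContDiff

noncomputable section

/-! ### The square, its boundary, and partial derivatives -/

/-- The open square `Ω = (0, L) × (0, L)`. -/
def openSquare (L : ℝ) : Set (ℝ × ℝ) := Ioo 0 L ×ˢ Ioo 0 L

/-- Lebesgue measure on the square. -/
def squareMeasure (L : ℝ) : Measure (ℝ × ℝ) := volume.restrict (openSquare L)

/-- Arc length on the boundary of the square: one-dimensional Lebesgue measure on each of the
four sides `x = 0`, `x = L`, `y = 0`, `y = L` (the corners are null). -/
def squareBoundaryMeasure (L : ℝ) : Measure (ℝ × ℝ) :=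
  ((volume.restrict (Ioo 0 L)).map (fun y : ℝ => ((0 : ℝ), y)) +
    (volume.restrict (Ioo 0 L)).map (fun y : ℝ => (L, y))) +
  ((volume.restrict (Ioo 0 L)).map (fun x : ℝ => (x, (0 : ℝ))) +
    (volume.restrict (Ioo 0 L)).map (fun x : ℝ => (x, L)))

/-- The space `L²(Ω)` of `𝕜`-valued functions. -/
abbrev SquareL2 (𝕜 : Type*) [RCLike 𝕜] (L : ℝ) : Type _ := Lp 𝕜 2 (squareMeasure L)

/-- The space `L²(∂Ω)` of `𝕜`-valued functions. -/
abbrev SquareBoundaryL2 (𝕜 : Type*) [RCLike 𝕜] (L : ℝ) : Type _ :=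
  Lp 𝕜 2 (squareBoundaryMeasure L)

/-- The classical partial derivative `∂f/∂x`. -/
def partialX {E : Type*} [NormedAddCommGroup E] [NormedSpace ℝ E] (f : ℝ × ℝ → E) :
    ℝ × ℝ → E :=
  fun p => deriv (fun t => f (t, p.2)) p.1

/-- The classical partial derivative `∂f/∂y`. -/
def partialY {E : Type*} [NormedAddCommGroup E] [NormedSpace ℝ E] (f : ℝ × ℝ → E) :
    ℝ × ℝ → E :=
  fun p => deriv (fun t => f (p.1, t)) p.2

/-- The classical derivative `D^α f = ∂_x^{α₁} ∂_y^{α₂} f`. -/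
def iteratedPartial {E : Type*} [NormedAddCommGroup E] [NormedSpace ℝ E] (α : ℕ × ℕ)
    (f : ℝ × ℝ → E) : ℝ × ℝ → E :=
  partialX^[α.1] (partialY^[α.2] f)

/-- Test functions on the square: smooth, with compact support contained in `Ω`. -/
structure IsSquareTest (L : ℝ) (φ : ℝ × ℝ → ℝ) : Prop where
  smooth : ContDiff ℝ ∞ φ
  compact : HasCompactSupport φ
  support : tsupport φ ⊆ openSquare L

/-! ### Weak derivatives -/

section Weak

variable {𝕜 : Type*} [RCLike 𝕜] {L : ℝ}

/-- `v` is the weak derivative `D^α u` on `Ω`. -/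
def IsWeakDeriv (α : ℕ × ℕ) (u v : SquareL2 𝕜 L) : Prop :=
  ∀ φ : ℝ × ℝ → ℝ, IsSquareTest L φ →
    ∫ p, iteratedPartial α φ p • u p ∂squareMeasure L =
      (-1 : ℝ) ^ (α.1 + α.2) • ∫ p, φ p • v p ∂squareMeasure L

open Classical in
/-- The weak derivative `D^α u` in `L²(Ω)`; it is `0` if there is none. -/
def weakDeriv (α : ℕ × ℕ) (u : SquareL2 𝕜 L) : SquareL2 𝕜 L :=
  if h : ∃ v, IsWeakDeriv α u v then h.choose else 0

theorem isOpen_openSquare (L : ℝ) : IsOpen (openSquare L) := isOpen_Ioo.prod isOpen_Ioo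

theorem contDiff_partialX {E : Type*} [NormedAddCommGroup E] [NormedSpace ℝ E]
    {f : ℝ × ℝ → E} (hf : ContDiff ℝ ∞ f) : ContDiff ℝ ∞ (partialX f) := by
  have h : partialX f = fun p => fderiv ℝ f p (1, 0) := by
    funext p
    have h1 : HasDerivAt (fun t : ℝ => (t, p.2)) ((1 : ℝ), (0 : ℝ)) p.1 :=
      (hasDerivAt_id p.1).prodMk (hasDerivAt_const p.1 p.2)
    have h2 : HasFDerivAt f (fderiv ℝ f p) (p.1, p.2) :=
      (hf.differentiable (by simp) p).hasFDerivAt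
    exact (h2.comp_hasDerivAt p.1 h1).deriv
  rw [h]
  exact (hf.fderiv_right (m := ∞) (by simp)).clm_apply contDiff_const

theorem contDiff_partialY {E : Type*} [NormedAddCommGroup E] [NormedSpace ℝ E]
    {f : ℝ × ℝ → E} (hf : ContDiff ℝ ∞ f) : ContDiff ℝ ∞ (partialY f) := by
  have h : partialY f = fun p => fderiv ℝ f p (0, 1) := by
    funext p
    have h1 : HasDerivAt (fun t : ℝ => (p.1, t)) ((0 : ℝ), (1 : ℝ)) p.2 :=
      (hasDerivAt_const p.2 p.1).prodMk (hasDerivAt_id p.2)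
    have h2 : HasFDerivAt f (fderiv ℝ f p) (p.1, p.2) :=
      (hf.differentiable (by simp) p).hasFDerivAt
    exact (h2.comp_hasDerivAt p.2 h1).deriv
  rw [h]
  exact (hf.fderiv_right (m := ∞) (by simp)).clm_apply contDiff_const

theorem contDiff_iteratedPartial {E : Type*} [NormedAddCommGroup E] [NormedSpace ℝ E]
    {f : ℝ × ℝ → E} (hf : ContDiff ℝ ∞ f) (α : ℕ × ℕ) :
    ContDiff ℝ ∞ (iteratedPartial α f) := by
  unfold iteratedPartial
  have hy : ∀ n : ℕ, ContDiff ℝ ∞ (partialY^[n] f) := by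
    intro n
    induction n with
    | zero => exact hf
    | succ n ih => rw [Function.iterate_succ_apply']; exact contDiff_partialY ih
  have hx : ∀ n : ℕ, ContDiff ℝ ∞ (partialX^[n] (partialY^[α.2] f)) := by
    intro n
    induction n with
    | zero => exact hy _
    | succ n ih => rw [Function.iterate_succ_apply']; exact contDiff_partialX ih
  exact hx _

instance (L : ℝ) : IsFiniteMeasure (squareMeasure L) := by
  refine ⟨?_⟩
  rw [squareMeasure, Measure.restrict_apply_univ, openSquare, Measure.volume_eq_prod,
    Measure.prod_prod]
  exact ENNReal.mul_lt_top (by simp) (by simp)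

instance (L : ℝ) : IsFiniteMeasure (squareBoundaryMeasure L) := by
  unfold squareBoundaryMeasure
  infer_instance

theorem integrable_smul_squareL2 {f : ℝ × ℝ → ℝ} (hf : Continuous f) (u : SquareL2 𝕜 L) :
    Integrable (fun p => f p • u p) (squareMeasure L) := by
  have hu : Integrable u (squareMeasure L) := (Lp.memLp u).integrable (by norm_num)
  have hK : IsCompact (Icc (0 : ℝ) L ×ˢ Icc (0 : ℝ) L) := isCompact_Icc.prod isCompact_Icc
  obtain ⟨C, hC⟩ := hK.exists_bound_of_continuousOn hf.continuousOn
  refine hu.bdd_smul C hf.aestronglyMeasurable ?_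
  refine ae_restrict_of_forall_mem (isOpen_openSquare L).measurableSet ?_
  intro p hp
  exact hC p ⟨Ioo_subset_Icc_self hp.1, Ioo_subset_Icc_self hp.2⟩

/-- A weak derivative is unique. -/
theorem IsWeakDeriv.unique {α : ℕ × ℕ} {u v v' : SquareL2 𝕜 L} (h : IsWeakDeriv α u v)
    (h' : IsWeakDeriv α u v') : v = v' := by
  have hint : Integrable (fun p => v p - v' p) (squareMeasure L) :=
    ((Lp.memLp v).integrable (by norm_num)).sub ((Lp.memLp v').integrable (by norm_num))
  have key : ∀ᵐ p ∂volume, p ∈ openSquare L → v p - v' p = 0 := by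
    refine (isOpen_openSquare L).ae_eq_zero_of_integral_contDiff_smul_eq_zero
      (IntegrableOn.locallyIntegrableOn hint) ?_
    intro φ hφ hc hs
    have e := (h φ ⟨hφ, hc, hs⟩).symm.trans (h' φ ⟨hφ, hc, hs⟩)
    have e' : ∫ p, φ p • v p ∂squareMeasure L = ∫ p, φ p • v' p ∂squareMeasure L :=
      smul_right_injective 𝕜 (pow_ne_zero _ (by norm_num : (-1 : ℝ) ≠ 0)) e
    have h0 : ∫ p, φ p • (v p - v' p) ∂squareMeasure L = 0 := by
      simp only [smul_sub]
      rw [integral_sub (integrable_smul_squareL2 hφ.continuous v)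
        (integrable_smul_squareL2 hφ.continuous v'), e', sub_self]
    rw [← h0]
    refine (setIntegral_eq_integral_of_forall_compl_eq_zero ?_).symm
    intro p hp
    have : φ p = 0 := image_eq_zero_of_notMem_tsupport (fun hq => hp (hs hq))
    simp [this]
  apply Lp.ext
  have := (ae_restrict_iff' (isOpen_openSquare L).measurableSet).2 key
  filter_upwards [this] with p hp
  exact sub_eq_zero.1 hp

theorem IsWeakDeriv.weakDeriv_eq {α : ℕ × ℕ} {u v : SquareL2 𝕜 L} (h : IsWeakDeriv α u v) :
    weakDeriv α u = v := by
  have hex : ∃ v, IsWeakDeriv α u v := ⟨v, h⟩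
  rw [weakDeriv, dif_pos hex]
  exact hex.choose_spec.unique h

theorem isWeakDeriv_weakDeriv {α : ℕ × ℕ} {u : SquareL2 𝕜 L} (h : ∃ v, IsWeakDeriv α u v) :
    IsWeakDeriv α u (weakDeriv α u) := by
  obtain ⟨v, hv⟩ := h
  rwa [hv.weakDeriv_eq]

theorem isWeakDeriv_zero_index (u : SquareL2 𝕜 L) : IsWeakDeriv (0, 0) u u := by
  intro φ _
  simp [iteratedPartial]

theorem IsWeakDeriv.add {α : ℕ × ℕ} {u u' v v' : SquareL2 𝕜 L} (h : IsWeakDeriv α u v)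
    (h' : IsWeakDeriv α u' v') : IsWeakDeriv α (u + u') (v + v') := by
  have key : ∀ (f : ℝ × ℝ → ℝ) (_ : Continuous f) (a b : SquareL2 𝕜 L),
      ∫ p, f p • (a + b : SquareL2 𝕜 L) p ∂squareMeasure L =
        (∫ p, f p • a p ∂squareMeasure L) + ∫ p, f p • b p ∂squareMeasure L := by
    intro f hf a b
    rw [← integral_add (integrable_smul_squareL2 hf a) (integrable_smul_squareL2 hf b)]
    refine integral_congr_ae ?_
    have hab : ⇑(a + b) =ᵐ[squareMeasure L] ⇑a + ⇑b := Lp.coeFn_add a b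
    filter_upwards [hab] with p hp
    rw [hp, Pi.add_apply, smul_add]
  intro φ hφ
  rw [key _ (contDiff_iteratedPartial hφ.smooth α).continuous, key _ hφ.smooth.continuous,
    h φ hφ, h' φ hφ, smul_add]

theorem IsWeakDeriv.const_smul {α : ℕ × ℕ} {u v : SquareL2 𝕜 L} (c : 𝕜)
    (h : IsWeakDeriv α u v) : IsWeakDeriv α (c • u) (c • v) := by
  have key : ∀ (f : ℝ × ℝ → ℝ) (a : SquareL2 𝕜 L),
      ∫ p, f p • (c • a : SquareL2 𝕜 L) p ∂squareMeasure L =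
        c • ∫ p, f p • a p ∂squareMeasure L := by
    intro f a
    rw [← integral_smul]
    refine integral_congr_ae ?_
    have ha : ⇑(c • a) =ᵐ[squareMeasure L] c • ⇑a := Lp.coeFn_smul c a
    filter_upwards [ha] with p hp
    rw [hp, Pi.smul_apply, smul_comm]
  intro φ hφ
  rw [key, key, h φ hφ, smul_comm]

variable (𝕜 L) in
/-- The Sobolev space `H^m(Ω)`: functions in `L²(Ω)` with weak derivatives `D^α u` in `L²(Ω)`
for all `|α| ≤ m`. -/
def sobolevSubmodule (m : ℕ) : Submodule 𝕜 (SquareL2 𝕜 L) where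
  carrier := {u | ∀ α : ℕ × ℕ, α.1 + α.2 ≤ m → ∃ v, IsWeakDeriv α u v}
  add_mem' := fun ha hb α hα =>
    ⟨_, (isWeakDeriv_weakDeriv (ha α hα)).add (isWeakDeriv_weakDeriv (hb α hα))⟩
  zero_mem' := fun α _ => ⟨0, by
    intro φ _
    have hz : ⇑(0 : SquareL2 𝕜 L) =ᵐ[squareMeasure L] 0 := Lp.coeFn_zero 𝕜 2 _
    have hzero : ∀ f : ℝ × ℝ → ℝ, ∫ p, f p • (0 : SquareL2 𝕜 L) p ∂squareMeasure L = 0 := by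
      intro f
      refine integral_eq_zero_of_ae ?_
      filter_upwards [hz] with p hp
      rw [hp, Pi.zero_apply, smul_zero]
    rw [hzero, hzero, smul_zero]⟩
  smul_mem' := fun c _ ha α hα => ⟨_, (isWeakDeriv_weakDeriv (ha α hα)).const_smul c⟩

theorem weakDeriv_add {m : ℕ} {u v : SquareL2 𝕜 L} (hu : u ∈ sobolevSubmodule 𝕜 L m)
    (hv : v ∈ sobolevSubmodule 𝕜 L m) {α : ℕ × ℕ} (hα : α.1 + α.2 ≤ m) :
    weakDeriv α (u + v) = weakDeriv α u + weakDeriv α v :=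
  ((isWeakDeriv_weakDeriv (hu α hα)).add (isWeakDeriv_weakDeriv (hv α hα))).weakDeriv_eq

theorem weakDeriv_smul {m : ℕ} {u : SquareL2 𝕜 L} (hu : u ∈ sobolevSubmodule 𝕜 L m) (c : 𝕜)
    {α : ℕ × ℕ} (hα : α.1 + α.2 ≤ m) : weakDeriv α (c • u) = c • weakDeriv α u :=
  ((isWeakDeriv_weakDeriv (hu α hα)).const_smul c).weakDeriv_eq

/-! ### Traces and periodicity -/

/-- `f ∈ H¹(Ω)` has first weak derivatives `fx`, `fy` and trace `g ∈ L²(∂Ω)`: the trace is the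
continuous extension to `H¹(Ω)` of the restriction to `∂Ω` of functions smooth up to the
boundary, so there are smooth `φ n` with `φ n → f` in `H¹(Ω)` and `φ n → g` in `L²(∂Ω)`. -/
def IsTraceAux (f fx fy : SquareL2 𝕜 L) (g : SquareBoundaryL2 𝕜 L) : Prop :=
  ∃ φ : ℕ → ℝ × ℝ → 𝕜, (∀ n, ContDiff ℝ ∞ (φ n)) ∧
    Tendsto (fun n => eLpNorm (φ n - ⇑f) 2 (squareMeasure L)) atTop (𝓝 0) ∧
    Tendsto (fun n => eLpNorm (partialX (φ n) - ⇑fx) 2 (squareMeasure L)) atTop (𝓝 0) ∧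
    Tendsto (fun n => eLpNorm (partialY (φ n) - ⇑fy) 2 (squareMeasure L)) atTop (𝓝 0) ∧
    Tendsto (fun n => eLpNorm (φ n - ⇑g) 2 (squareBoundaryMeasure L)) atTop (𝓝 0)

/-- `g = Tr f` for `f ∈ H¹(Ω)`. -/
def IsTrace (f : SquareL2 𝕜 L) (g : SquareBoundaryL2 𝕜 L) : Prop :=
  f ∈ sobolevSubmodule 𝕜 L 1 ∧ IsTraceAux f (weakDeriv (1, 0) f) (weakDeriv (0, 1) f) g

/-- `Tr f` is `L`-periodic in `x`: it takes the same values on the sides `x = 0` and `x = L`. -/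
def TracePeriodicX (f : SquareL2 𝕜 L) : Prop :=
  ∃ g : SquareBoundaryL2 𝕜 L, IsTrace f g ∧ ∀ᵐ y ∂volume.restrict (Ioo 0 L), g (0, y) = g (L, y)

/-- `Tr f` is `L`-periodic in `y`: it takes the same values on the sides `y = 0` and `y = L`. -/
def TracePeriodicY (f : SquareL2 𝕜 L) : Prop :=
  ∃ g : SquareBoundaryL2 𝕜 L, IsTrace f g ∧ ∀ᵐ x ∂volume.restrict (Ioo 0 L), g (x, 0) = g (x, L)

theorem partialX_add {E : Type*} [NormedAddCommGroup E] [NormedSpace ℝ E] {f g : ℝ × ℝ → E}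
    (hf : ContDiff ℝ ∞ f) (hg : ContDiff ℝ ∞ g) :
    partialX (f + g) = partialX f + partialX g := by
  funext p
  have h : ∀ {k : ℝ × ℝ → E}, ContDiff ℝ ∞ k → DifferentiableAt ℝ (fun t => k (t, p.2)) p.1 :=
    fun hk => ((hk.comp (contDiff_id.prodMk contDiff_const)).differentiable (by simp)) p.1
  exact deriv_add (h hf) (h hg)

theorem partialY_add {E : Type*} [NormedAddCommGroup E] [NormedSpace ℝ E] {f g : ℝ × ℝ → E}
    (hf : ContDiff ℝ ∞ f) (hg : ContDiff ℝ ∞ g) :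
    partialY (f + g) = partialY f + partialY g := by
  funext p
  have h : ∀ {k : ℝ × ℝ → E}, ContDiff ℝ ∞ k → DifferentiableAt ℝ (fun t => k (p.1, t)) p.2 :=
    fun hk => ((hk.comp (contDiff_const.prodMk contDiff_id)).differentiable (by simp)) p.2
  exact deriv_add (h hf) (h hg)

theorem partialX_const_smul (c : 𝕜) (f : ℝ × ℝ → 𝕜) : partialX (c • f) = c • partialX f := by
  funext p
  exact deriv_const_smul_field c (fun t => f (t, p.2))

theorem partialY_const_smul (c : 𝕜) (f : ℝ × ℝ → 𝕜) : partialY (c • f) = c • partialY f := by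
  funext p
  exact deriv_const_smul_field c (fun t => f (p.1, t))

theorem tendsto_eLpNorm_sub_add {μ : Measure (ℝ × ℝ)} {a b : ℕ → ℝ × ℝ → 𝕜}
    (ha : ∀ n, Continuous (a n)) (hb : ∀ n, Continuous (b n)) (f g : Lp 𝕜 2 μ)
    (hf : Tendsto (fun n => eLpNorm (a n - ⇑f) 2 μ) atTop (𝓝 0))
    (hg : Tendsto (fun n => eLpNorm (b n - ⇑g) 2 μ) atTop (𝓝 0)) :
    Tendsto (fun n => eLpNorm (a n + b n - ⇑(f + g : Lp 𝕜 2 μ)) 2 μ) atTop (𝓝 0) := by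
  have hs := hf.add hg
  rw [add_zero] at hs
  refine tendsto_of_tendsto_of_tendsto_of_le_of_le tendsto_const_nhds hs
    (fun _ => zero_le) (fun n => ?_)
  have h1 : a n + b n - ⇑(f + g : Lp 𝕜 2 μ) =ᵐ[μ] (a n - ⇑f) + (b n - ⇑g) := by
    filter_upwards [Lp.coeFn_add f g] with p hp
    simp only [Pi.sub_apply, Pi.add_apply, hp]
    ring
  simp only []
  rw [eLpNorm_congr_ae h1]
  exact eLpNorm_add_le ((ha n).aestronglyMeasurable.sub (Lp.aestronglyMeasurable f))
    ((hb n).aestronglyMeasurable.sub (Lp.aestronglyMeasurable g)) (by norm_num)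

theorem tendsto_eLpNorm_sub_smul {μ : Measure (ℝ × ℝ)} {a : ℕ → ℝ × ℝ → 𝕜} (c : 𝕜)
    (f : Lp 𝕜 2 μ) (hf : Tendsto (fun n => eLpNorm (a n - ⇑f) 2 μ) atTop (𝓝 0)) :
    Tendsto (fun n => eLpNorm (c • a n - ⇑(c • f : Lp 𝕜 2 μ)) 2 μ) atTop (𝓝 0) := by
  have hs : Tendsto (fun n => ‖c‖ₑ * eLpNorm (a n - ⇑f) 2 μ) atTop (𝓝 (‖c‖ₑ * 0)) :=
    ENNReal.Tendsto.const_mul hf (Or.inr enorm_ne_top)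
  rw [mul_zero] at hs
  refine hs.congr (fun n => ?_)
  have h1 : c • a n - ⇑(c • f : Lp 𝕜 2 μ) =ᵐ[μ] c • (a n - ⇑f) := by
    filter_upwards [Lp.coeFn_smul c f] with p hp
    simp only [Pi.sub_apply, Pi.smul_apply, hp, smul_sub]
  rw [eLpNorm_congr_ae h1, eLpNorm_const_smul]

theorem IsTrace.add {f f' : SquareL2 𝕜 L} {g g' : SquareBoundaryL2 𝕜 L} (h : IsTrace f g)
    (h' : IsTrace f' g') : IsTrace (f + f') (g + g') := by
  obtain ⟨hf, φ, hφ, h1, h2, h3, h4⟩ := h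
  obtain ⟨hf', ψ, hψ, k1, k2, k3, k4⟩ := h'
  refine ⟨add_mem hf hf', fun n => φ n + ψ n, fun n => (hφ n).add (hψ n), ?_, ?_, ?_, ?_⟩
  · exact tendsto_eLpNorm_sub_add (fun n => (hφ n).continuous) (fun n => (hψ n).continuous)
      _ _ h1 k1
  · simp only [weakDeriv_add hf hf' (α := (1, 0)) le_rfl, partialX_add (hφ _) (hψ _)]
    exact tendsto_eLpNorm_sub_add (fun n => (contDiff_partialX (hφ n)).continuous)
      (fun n => (contDiff_partialX (hψ n)).continuous) _ _ h2 k2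
  · simp only [weakDeriv_add hf hf' (α := (0, 1)) le_rfl, partialY_add (hφ _) (hψ _)]
    exact tendsto_eLpNorm_sub_add (fun n => (contDiff_partialY (hφ n)).continuous)
      (fun n => (contDiff_partialY (hψ n)).continuous) _ _ h3 k3
  · exact tendsto_eLpNorm_sub_add (fun n => (hφ n).continuous) (fun n => (hψ n).continuous)
      _ _ h4 k4

theorem IsTrace.const_smul {f : SquareL2 𝕜 L} {g : SquareBoundaryL2 𝕜 L} (c : 𝕜)
    (h : IsTrace f g) : IsTrace (c • f) (c • g) := by
  obtain ⟨hf, φ, hφ, h1, h2, h3, h4⟩ := h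
  refine ⟨Submodule.smul_mem _ c hf, fun n => c • φ n, fun n => (hφ n).const_smul c,
    ?_, ?_, ?_, ?_⟩
  · exact tendsto_eLpNorm_sub_smul c _ h1
  · simp only [weakDeriv_smul hf c (α := (1, 0)) le_rfl, partialX_const_smul]
    exact tendsto_eLpNorm_sub_smul c _ h2
  · simp only [weakDeriv_smul hf c (α := (0, 1)) le_rfl, partialY_const_smul]
    exact tendsto_eLpNorm_sub_smul c _ h3
  · exact tendsto_eLpNorm_sub_smul c _ h4

/-- A property that holds almost everywhere on `∂Ω` holds almost everywhere on each side. -/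
theorem ae_sides {P : ℝ × ℝ → Prop} (h : ∀ᵐ p ∂squareBoundaryMeasure L, P p) :
    ((∀ᵐ y ∂volume.restrict (Ioo 0 L), P (0, y)) ∧ ∀ᵐ y ∂volume.restrict (Ioo 0 L), P (L, y)) ∧
    ((∀ᵐ x ∂volume.restrict (Ioo 0 L), P (x, 0)) ∧
      ∀ᵐ x ∂volume.restrict (Ioo 0 L), P (x, L)) := by
  simp only [squareBoundaryMeasure, ae_add_measure_iff] at h
  exact ⟨⟨ae_of_ae_map (by fun_prop) h.1.1, ae_of_ae_map (by fun_prop) h.1.2⟩,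
    ae_of_ae_map (by fun_prop) h.2.1, ae_of_ae_map (by fun_prop) h.2.2⟩

theorem TracePeriodicX.add {f f' : SquareL2 𝕜 L} (h : TracePeriodicX f)
    (h' : TracePeriodicX f') : TracePeriodicX (f + f') := by
  obtain ⟨g, hg, e⟩ := h
  obtain ⟨g', hg', e'⟩ := h'
  refine ⟨g + g', hg.add hg', ?_⟩
  obtain ⟨⟨s0, s1⟩, -⟩ := ae_sides (Lp.coeFn_add g g')
  filter_upwards [e, e', s0, s1] with y h1 h2 h3 h4
  rw [h3, h4, Pi.add_apply, Pi.add_apply, h1, h2]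

theorem TracePeriodicY.add {f f' : SquareL2 𝕜 L} (h : TracePeriodicY f)
    (h' : TracePeriodicY f') : TracePeriodicY (f + f') := by
  obtain ⟨g, hg, e⟩ := h
  obtain ⟨g', hg', e'⟩ := h'
  refine ⟨g + g', hg.add hg', ?_⟩
  obtain ⟨-, s0, s1⟩ := ae_sides (Lp.coeFn_add g g')
  filter_upwards [e, e', s0, s1] with y h1 h2 h3 h4
  rw [h3, h4, Pi.add_apply, Pi.add_apply, h1, h2]

theorem TracePeriodicX.const_smul {f : SquareL2 𝕜 L} (c : 𝕜) (h : TracePeriodicX f) :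
    TracePeriodicX (c • f) := by
  obtain ⟨g, hg, e⟩ := h
  refine ⟨c • g, hg.const_smul c, ?_⟩
  obtain ⟨⟨s0, s1⟩, -⟩ := ae_sides (Lp.coeFn_smul c g)
  filter_upwards [e, s0, s1] with y h1 h3 h4
  rw [h3, h4, Pi.smul_apply, Pi.smul_apply, h1]

theorem TracePeriodicY.const_smul {f : SquareL2 𝕜 L} (c : 𝕜) (h : TracePeriodicY f) :
    TracePeriodicY (c • f) := by
  obtain ⟨g, hg, e⟩ := h
  refine ⟨c • g, hg.const_smul c, ?_⟩
  obtain ⟨-, s0, s1⟩ := ae_sides (Lp.coeFn_smul c g)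
  filter_upwards [e, s0, s1] with y h1 h3 h4
  rw [h3, h4, Pi.smul_apply, Pi.smul_apply, h1]

theorem isTrace_zero : IsTrace (0 : SquareL2 𝕜 L) 0 := by
  have hd : ∀ α : ℕ × ℕ, α.1 + α.2 ≤ 1 → weakDeriv α (0 : SquareL2 𝕜 L) = 0 := by
    intro α hα
    have := weakDeriv_smul (zero_mem (sobolevSubmodule 𝕜 L 1)) (0 : 𝕜) hα
    rwa [zero_smul, zero_smul] at this
  have hz : ∀ μ : Measure (ℝ × ℝ),
      eLpNorm ((0 : ℝ × ℝ → 𝕜) - ((0 : Lp 𝕜 2 μ) : ℝ × ℝ → 𝕜)) 2 μ = 0 := by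
    intro μ
    have h1 : (0 : ℝ × ℝ → 𝕜) - ((0 : Lp 𝕜 2 μ) : ℝ × ℝ → 𝕜) =ᵐ[μ] 0 := by
      filter_upwards [Lp.coeFn_zero 𝕜 2 μ] with p hp
      rw [Pi.sub_apply, hp, sub_self]
      rfl
    rw [eLpNorm_congr_ae h1, eLpNorm_zero]
  have hX : partialX (0 : ℝ × ℝ → 𝕜) = 0 := by funext p; simp [partialX]
  have hY : partialY (0 : ℝ × ℝ → 𝕜) = 0 := by funext p; simp [partialY]
  refine ⟨zero_mem _, fun _ => 0, fun _ => contDiff_const, ?_, ?_, ?_, ?_⟩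
  · simp only [hz]; exact tendsto_const_nhds
  · simp only [hd (1, 0) le_rfl, hX, hz]; exact tendsto_const_nhds
  · simp only [hd (0, 1) le_rfl, hY, hz]; exact tendsto_const_nhds
  · simp only [hz]; exact tendsto_const_nhds

theorem tracePeriodicX_zero : TracePeriodicX (0 : SquareL2 𝕜 L) := by
  refine ⟨0, isTrace_zero, ?_⟩
  obtain ⟨⟨s0, s1⟩, -⟩ := ae_sides (Lp.coeFn_zero 𝕜 2 (squareBoundaryMeasure L))
  filter_upwards [s0, s1] with y h3 h4
  rw [h3, h4, Pi.zero_apply, Pi.zero_apply]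

theorem tracePeriodicY_zero : TracePeriodicY (0 : SquareL2 𝕜 L) := by
  refine ⟨0, isTrace_zero, ?_⟩
  obtain ⟨-, s0, s1⟩ := ae_sides (Lp.coeFn_zero 𝕜 2 (squareBoundaryMeasure L))
  filter_upwards [s0, s1] with y h3 h4
  rw [h3, h4, Pi.zero_apply, Pi.zero_apply]

end Weak

/-! ### Periodic Sobolev spaces -/

variable (𝕜 : Type*) [RCLike 𝕜] (L : ℝ) (m : ℕ)

/-- The periodic Sobolev space `H_P^m(Ω)` as a subspace of `L²(Ω)`: those `u ∈ H^m(Ω)` such that,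
for `k = 0, …, m - 1`, the trace of `∂_x^k u` is `L`-periodic in `x` and the trace of `∂_y^k u`
is `L`-periodic in `y`. For `m = 0` this is `L²(Ω)`. -/
def periodicSobolevSubmodule : Submodule 𝕜 (SquareL2 𝕜 L) where
  carrier := {u | u ∈ sobolevSubmodule 𝕜 L m ∧
    ∀ k < m, TracePeriodicX (weakDeriv (k, 0) u) ∧ TracePeriodicY (weakDeriv (0, k) u)}
  add_mem' := fun ha hb => ⟨add_mem ha.1 hb.1, fun k hk => by
    rw [weakDeriv_add ha.1 hb.1 (α := (k, 0)) (by simpa using hk.le),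
      weakDeriv_add ha.1 hb.1 (α := (0, k)) (by simpa using hk.le)]
    exact ⟨(ha.2 k hk).1.add (hb.2 k hk).1, (ha.2 k hk).2.add (hb.2 k hk).2⟩⟩
  zero_mem' := ⟨zero_mem _, fun k hk => by
    have hd : ∀ α : ℕ × ℕ, α.1 + α.2 ≤ m → weakDeriv α (0 : SquareL2 𝕜 L) = 0 := by
      intro α hα
      have := weakDeriv_smul (zero_mem (sobolevSubmodule 𝕜 L m)) (0 : 𝕜) hα
      rwa [zero_smul, zero_smul] at this
    rw [hd (k, 0) (by simpa using hk.le), hd (0, k) (by simpa using hk.le)]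
    exact ⟨tracePeriodicX_zero, tracePeriodicY_zero⟩⟩
  smul_mem' := fun c _ ha => ⟨Submodule.smul_mem _ c ha.1, fun k hk => by
    rw [weakDeriv_smul ha.1 c (α := (k, 0)) (by simpa using hk.le),
      weakDeriv_smul ha.1 c (α := (0, k)) (by simpa using hk.le)]
    exact ⟨(ha.2 k hk).1.const_smul c, (ha.2 k hk).2.const_smul c⟩⟩

/-- The periodic Sobolev space `H_P^m(Ω)`, to be normed by the `H^m` norm (hence a new type and
not the subspace, which carries the `L²` norm). -/
def PeriodicSobolev : Type _ := periodicSobolevSubmodule 𝕜 L m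

namespace PeriodicSobolev

instance : AddCommGroup (PeriodicSobolev 𝕜 L m) :=
  inferInstanceAs (AddCommGroup (periodicSobolevSubmodule 𝕜 L m))

instance : Module 𝕜 (PeriodicSobolev 𝕜 L m) :=
  inferInstanceAs (Module 𝕜 (periodicSobolevSubmodule 𝕜 L m))

instance : Module ℝ (PeriodicSobolev 𝕜 L m) :=
  inferInstanceAs (Module ℝ (periodicSobolevSubmodule 𝕜 L m))

/-- The inclusion `H_P^m(Ω) → L²(Ω)`. -/
def toL2 {𝕜 : Type*} [RCLike 𝕜] {L : ℝ} {m : ℕ} (u : PeriodicSobolev 𝕜 L m) : SquareL2 𝕜 L :=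
  Subtype.val u

/-- The multi-indices `α` with `|α| ≤ m`. -/
def multiIndices (m : ℕ) : Finset (ℕ × ℕ) :=
  {α ∈ Finset.range (m + 1) ×ˢ Finset.range (m + 1) | α.1 + α.2 ≤ m}

theorem le_of_mem_multiIndices {m : ℕ} {α : ℕ × ℕ} (h : α ∈ multiIndices m) :
    α.1 + α.2 ≤ m := (Finset.mem_filter.1 h).2

/-- The map `u ↦ (D^α u)_{|α| ≤ m}` into a Hilbert sum of copies of `L²(Ω)`. -/
def jet : PeriodicSobolev 𝕜 L m →+ PiLp 2 (fun _ : multiIndices m => SquareL2 𝕜 L) where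
  toFun u := WithLp.toLp 2 fun α => weakDeriv α.1 u.toL2
  map_zero' := by
    ext1 α
    have := weakDeriv_smul (zero_mem (sobolevSubmodule 𝕜 L m)) (0 : 𝕜)
      (le_of_mem_multiIndices α.2)
    rwa [zero_smul, zero_smul] at this
  map_add' u v := by
    ext1 α
    exact weakDeriv_add u.2.1 v.2.1 (le_of_mem_multiIndices α.2)

theorem jet_injective : Function.Injective (jet 𝕜 L m) := by
  intro u v h
  have h0 : ((0 : ℕ), (0 : ℕ)) ∈ multiIndices m := by simp [multiIndices]
  have h1 : weakDeriv (0, 0) u.toL2 = weakDeriv (0, 0) v.toL2 :=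
    congrArg (fun z : PiLp 2 (fun _ : multiIndices m => SquareL2 𝕜 L) => z ⟨(0, 0), h0⟩) h
  rw [(isWeakDeriv_zero_index u.toL2).weakDeriv_eq,
    (isWeakDeriv_zero_index v.toL2).weakDeriv_eq] at h1
  exact Subtype.ext h1

/-- The `H^m` norm, see `PeriodicSobolev.norm_eq`. -/
instance : NormedAddCommGroup (PeriodicSobolev 𝕜 L m) :=
  NormedAddCommGroup.induced _ _ (jet 𝕜 L m) (jet_injective 𝕜 L m)

variable {𝕜 L m} in
/-- `‖u‖_{H^m} = (∑_{|α| ≤ m} ‖D^α u‖²_{L²})^{1/2}`. -/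
theorem norm_eq (u : PeriodicSobolev 𝕜 L m) :
    ‖u‖ = √(∑ α ∈ multiIndices m, ‖weakDeriv α u.toL2‖ ^ 2) := by
  have h : ‖u‖ = ‖jet 𝕜 L m u‖ := rfl
  rw [h, PiLp.norm_eq_of_L2, ← Finset.sum_coe_sort (multiIndices m)]
  rfl

instance : NormedSpace 𝕜 (PeriodicSobolev 𝕜 L m) where
  norm_smul_le c u := by
    have h : jet 𝕜 L m (c • u) = c • jet 𝕜 L m u := by
      ext1 α
      exact weakDeriv_smul u.2.1 c (le_of_mem_multiIndices α.2)
    have h' : ‖c • u‖ = ‖jet 𝕜 L m (c • u)‖ := rfl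
    rw [h', h]
    exact norm_smul_le c _

instance : NormedSpace ℝ (PeriodicSobolev 𝕜 L m) where
  norm_smul_le c u := by
    have h : c • u = (c : 𝕜) • u := Subtype.ext (RCLike.real_smul_eq_coe_smul c u.toL2)
    rw [h]
    exact (norm_smul_le (c : 𝕜) u).trans (by rw [RCLike.norm_ofReal, Real.norm_eq_abs])

end PeriodicSobolev

end

/-- The equation `-Δu + u = w` holds almost everywhere on `Ω`. -/
def SolvesElliptic {𝕜 : Type*} [RCLike 𝕜] {L : ℝ} {m n : ℕ} (u : PeriodicSobolev 𝕜 L n)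
    (w : PeriodicSobolev 𝕜 L m) : Prop :=
  ∀ᵐ p ∂squareMeasure L,
    -(weakDeriv (2, 0) u.toL2 p + weakDeriv (0, 2) u.toL2 p) + u.toL2 p = w.toL2 p

/-- `z` is the weak derivative `∂w/∂t` on `(0, T)` of the `H_P^m(Ω)`-valued function `w`. -/
def IsWeakTimeDeriv {𝕜 : Type*} [RCLike 𝕜] {L : ℝ} {m : ℕ} (T : ℝ)
    (w z : ℝ → PeriodicSobolev 𝕜 L m) : Prop :=
  ∀ φ : ℝ → ℝ, ContDiff ℝ ∞ φ → HasCompactSupport φ → tsupport φ ⊆ Ioo 0 T →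
    ∫ t in Ioo 0 T, deriv φ t • (w t).toL2 = -∫ t in Ioo 0 T, φ t • (z t).toL2

/-!
The proof diagonalizes the problem by a Fourier series. To treat `𝕜 = ℝ` and `𝕜 = ℂ` at once, the
exponentials are replaced by the real Hartley functions `h_j(x) = (cos λ_j x + sin λ_j x) / √L`,
`λ_j = 2πj/L`, `j ∈ ℤ`. They satisfy `h_j' = λ_j h_{-j}`, and the products
`h_ξ(x, y) = h_i(x) h_j(y)`, `ξ = (i, j)`, form a Hilbert basis of `L²(Ω; 𝕜)` (`hartleyBasis`):
completeness follows from Parseval's identity on an interval, applied in each variable.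

On coefficients, `∂/∂x` should act as `c(i, j) ↦ -λ_i c(-i, j)` and similarly for `∂/∂y`
(`coeffDeriv` for a general `D^α`). Two facts make this rigorous.

* If the formally differentiated series is square summable, it is the weak derivative
  (`isWeakDeriv_of_hartleyCoeff`), because the statement is true for test functions and Parseval's
  identity transposes it. Moreover the partial sums, which are smooth and periodic, then converge
  in `H¹(Ω)`, hence by the trace inequality in `L²(∂Ω)`, so that the trace exists and is periodic
  (`tracePeriodic_of_hartleyCoeff`).
* Conversely, if `u ∈ H_P^m(Ω)`, integrating the smooth approximations of `∂_x^k u` by parts leaves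
  a boundary term that vanishes in the limit since the traces match
  (`TracePeriodicX.hartleyCoeff_weakDeriv`). So the pure derivatives `∂_x^k u`, `∂_y^k u`, `k ≤ m`,
  have the expected coefficients; the mixed ones are dominated by these.

Hence `H_P^m(Ω)` is the weighted `ℓ²` space with weight `∑_{|α| ≤ m} λ_i^{2α₁} λ_j^{2α₂}`
(`mem_periodicSobolevSubmodule_of_summable`, `hasSum_sobolevWeight`), and the equation becomes
multiplication by `1 + λ_i² + λ_j² ≥ 1` (`solvesElliptic_iff`). Existence and uniqueness are
immediate, and the estimate is the comparison `sobolevWeight_add_two_le` of weights, which holds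
for all real `λ_i`, `λ_j` and therefore with a constant independent of `L`. The solution operator
is a bounded linear map, so it preserves `C^n` and `L^p` regularity in time; the weak time
derivative is compared coefficient by coefficient, where the Bochner integral commutes with taking
a coefficient.
-/

/-! ### The Hartley basis of an interval -/

/-- The angular frequency `2πj/L`. -/
noncomputable def freq (L : ℝ) (j : ℤ) : ℝ := 2 * Real.pi * j / L

theorem freq_neg (L : ℝ) (j : ℤ) : freq L (-j) = -freq L j := by
  simp only [freq, Int.cast_neg]; ring

theorem freq_mul_self {L : ℝ} (hL : 0 < L) (j : ℤ) : freq L j * L = j * (2 * Real.pi) := by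
  rw [freq]; field_simp

/-- The normalized Hartley function `x ↦ (cos (2πjx/L) + sin (2πjx/L)) / √L`. -/
noncomputable def hartley (L : ℝ) (j : ℤ) (x : ℝ) : ℝ :=
  (Real.cos (freq L j * x) + Real.sin (freq L j * x)) / √L

theorem contDiff_hartley (L : ℝ) (j : ℤ) : ContDiff ℝ ∞ (hartley L j) := by
  unfold hartley
  fun_prop

theorem hartley_period {L : ℝ} (hL : 0 < L) (j : ℤ) : hartley L j L = hartley L j 0 := by
  simp only [hartley, freq_mul_self hL, mul_zero, Real.cos_int_mul_two_pi, Real.cos_zero,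
    Real.sin_zero]
  have : Real.sin (j * (2 * Real.pi)) = 0 := by
    rw [← mul_assoc]; exact_mod_cast Real.sin_int_mul_pi (j * 2)
  rw [this]

theorem hasDerivAt_hartley (L : ℝ) (j : ℤ) (x : ℝ) :
    HasDerivAt (hartley L j) (freq L j * hartley L (-j) x) x := by
  have h1 : HasDerivAt (fun y => freq L j * y) (freq L j) x := by
    simpa using (hasDerivAt_id x).const_mul (freq L j)
  have h := (h1.cos.add h1.sin).div_const (√L)
  refine HasDerivAt.congr_deriv h ?_
  simp only [hartley, freq_neg, neg_mul, Real.cos_neg, Real.sin_neg]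
  ring

theorem integral_cos_freq {L : ℝ} (hL : 0 < L) (k : ℤ) :
    ∫ x in (0 : ℝ)..L, Real.cos (freq L k * x) = if k = 0 then L else 0 := by
  split_ifs with h
  · simp [h, freq]
  · have hk : freq L k ≠ 0 := by
      have : (k : ℝ) ≠ 0 := by exact_mod_cast h
      rw [freq]; positivity
    have hs : Real.sin (k * (2 * Real.pi)) = 0 := by
      rw [← mul_assoc]; exact_mod_cast Real.sin_int_mul_pi (k * 2)
    rw [intervalIntegral.integral_comp_mul_left _ hk, integral_cos, freq_mul_self hL, hs]
    simp

theorem integral_sin_freq {L : ℝ} (hL : 0 < L) (k : ℤ) :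
    ∫ x in (0 : ℝ)..L, Real.sin (freq L k * x) = 0 := by
  by_cases h : k = 0
  · simp [h, freq]
  · have hk : freq L k ≠ 0 := by
      have : (k : ℝ) ≠ 0 := by exact_mod_cast h
      rw [freq]; positivity
    rw [intervalIntegral.integral_comp_mul_left _ hk, integral_sin, freq_mul_self hL]
    simp

/-- Orthonormality, since `cas a * cas b = cos (a - b) + sin (a + b)` for `cas = cos + sin`. -/
theorem integral_hartley_mul {L : ℝ} (hL : 0 < L) (i j : ℤ) :
    ∫ x in Ioo 0 L, hartley L i x * hartley L j x = if i = j then 1 else 0 := by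
  have h : ∀ x, hartley L i x * hartley L j x =
      (Real.cos (freq L (i - j) * x) + Real.sin (freq L (i + j) * x)) / L := by
    intro x
    have e1 : freq L (i - j) * x = freq L i * x - freq L j * x := by
      simp only [freq]; push_cast; ring
    have e2 : freq L (i + j) * x = freq L i * x + freq L j * x := by
      simp only [freq]; push_cast; ring
    rw [e1, e2, Real.cos_sub, Real.sin_add, hartley, hartley, div_mul_div_comm,
      Real.mul_self_sqrt hL.le]
    ring
  simp only [h]
  rw [← integral_Ioc_eq_integral_Ioo, ← intervalIntegral.integral_of_le hL.le,
    intervalIntegral.integral_div, intervalIntegral.integral_add, integral_cos_freq hL,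
    integral_sin_freq hL]
  · simp only [sub_eq_zero, add_zero]
    split_ifs
    · field_simp
    · simp
  · exact (by fun_prop : Continuous _).intervalIntegrable _ _
  · exact (by fun_prop : Continuous _).intervalIntegrable _ _

/-- Completeness of the Hartley functions among real functions. Comparing `j` with `-j` separates
the cosine from the sine integrals, so all Fourier coefficients vanish. -/
theorem ae_eq_zero_of_integral_hartley_eq_zero_real {L : ℝ} (hL : 0 < L) {f : ℝ → ℝ}
    (hf : MemLp f 2 (volume.restrict (Ioo 0 L)))
    (h : ∀ j, ∫ x in Ioo 0 L, hartley L j x * f x = 0) : f =ᵐ[volume.restrict (Ioo 0 L)] 0 := by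
  have hfi : Integrable f (volume.restrict (Ioo 0 L)) := hf.integrable (by norm_num)
  have hbd : ∀ g : ℝ → ℝ, Continuous g → (∀ x, |g x| ≤ 1) →
      Integrable (fun x => g x * f x) (volume.restrict (Ioo 0 L)) := fun g hg hb =>
    hfi.bdd_mul (c := 1) hg.aestronglyMeasurable (Eventually.of_forall hb)
  have hc : ∀ j, Integrable (fun x => Real.cos (freq L j * x) * f x)
      (volume.restrict (Ioo 0 L)) := fun j =>
    hbd _ (by fun_prop) (fun x => Real.abs_cos_le_one _)
  have hs : ∀ j, Integrable (fun x => Real.sin (freq L j * x) * f x)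
      (volume.restrict (Ioo 0 L)) := fun j =>
    hbd _ (by fun_prop) (fun x => Real.abs_sin_le_one _)
  have key : ∀ j, (∫ x in Ioo 0 L, Real.cos (freq L j * x) * f x) +
      ∫ x in Ioo 0 L, Real.sin (freq L j * x) * f x = 0 := by
    intro j
    have h1 : ∀ x, hartley L j x * f x =
        (Real.cos (freq L j * x) * f x + Real.sin (freq L j * x) * f x) / √L := by
      intro x; rw [hartley]; ring
    have h2 := h j
    simp only [h1] at h2
    rw [integral_div, integral_add (hc j) (hs j), div_eq_zero_iff] at h2
    exact h2.resolve_right (Real.sqrt_pos.2 hL).ne'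
  have key' : ∀ j, (∫ x in Ioo 0 L, Real.cos (freq L j * x) * f x) -
      ∫ x in Ioo 0 L, Real.sin (freq L j * x) * f x = 0 := by
    intro j
    have := key (-j)
    simp only [freq_neg, neg_mul, Real.cos_neg, Real.sin_neg, integral_neg] at this
    linarith
  have kc : ∀ j, ∫ x in Ioo 0 L, Real.cos (freq L j * x) * f x = 0 := fun j => by
    linarith [key j, key' j]
  have ks : ∀ j, ∫ x in Ioo 0 L, Real.sin (freq L j * x) * f x = 0 := fun j => by
    linarith [key j, key' j]
  have hF : ∀ n, fourierCoeffOn hL (fun x => (f x : ℂ)) n = 0 := by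
    intro n
    rw [fourierCoeffOn_eq_integral, intervalIntegral.integral_of_le hL.le,
      integral_Ioc_eq_integral_Ioo]
    have e : ∀ x : ℝ, fourier (-n) (x : AddCircle (L - 0)) • (f x : ℂ) =
        ((Real.cos (freq L n * x) * f x : ℝ) : ℂ) -
          Complex.I * ((Real.sin (freq L n * x) * f x : ℝ) : ℂ) := by
      intro x
      rw [fourier_coe_apply, sub_zero, smul_eq_mul,
        show 2 * (Real.pi : ℂ) * Complex.I * ((-n : ℤ) : ℂ) * x / L =
          ((-(freq L n * x) : ℝ) : ℂ) * Complex.I by simp only [freq]; push_cast; ring,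
        Complex.exp_mul_I]
      push_cast
      rw [Complex.cos_neg, Complex.sin_neg]
      ring
    simp only [e]
    rw [integral_sub (hc n).ofReal ((hs n).ofReal.const_mul _), integral_const_mul,
      integral_complex_ofReal, integral_complex_ofReal, kc, ks]
    simp
  have hm : MemLp (fun x => (f x : ℂ)) 2 (volume.restrict (Ioc 0 L)) := by
    rw [← restrict_Ioo_eq_restrict_Ioc]
    exact hf.ofReal
  have hz := hasSum_sq_fourierCoeffOn hL hm
  simp only [hF, norm_zero, ne_eq, OfNat.ofNat_ne_zero, not_false_eq_true, zero_pow] at hz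
  replace hz := hz.unique hasSum_zero
  rw [smul_eq_zero, intervalIntegral.integral_of_le hL.le, integral_Ioc_eq_integral_Ioo] at hz
  have hz' := hz.resolve_left (by simpa using hL.ne')
  rw [integral_eq_zero_iff_of_nonneg (fun x => by positivity)] at hz'
  · filter_upwards [hz'] with x hx
    simpa using hx
  · have := hf.integrable_norm_pow (by norm_num)
    simpa using this

/-- Completeness of the Hartley functions on an interval. -/
theorem ae_eq_zero_of_integral_hartley_eq_zero {𝕜 : Type*} [RCLike 𝕜] {L : ℝ} (hL : 0 < L)
    {f : ℝ → 𝕜} (hf : MemLp f 2 (volume.restrict (Ioo 0 L)))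
    (h : ∀ j, ∫ x in Ioo 0 L, hartley L j x • f x = 0) :
    f =ᵐ[volume.restrict (Ioo 0 L)] 0 := by
  have hi : ∀ j, Integrable (fun x => hartley L j x • f x) (volume.restrict (Ioo 0 L)) := by
    intro j
    obtain ⟨C, hC⟩ := isCompact_Icc.exists_bound_of_continuousOn
      (contDiff_hartley L j).continuous.continuousOn (s := Icc 0 L)
    exact (hf.integrable (by norm_num)).bdd_smul C
      (contDiff_hartley L j).continuous.aestronglyMeasurable
      (ae_restrict_of_forall_mem measurableSet_Ioo fun x hx => hC x (Ioo_subset_Icc_self hx))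
  have hre := ae_eq_zero_of_integral_hartley_eq_zero_real hL hf.re (fun j => by
    have := congrArg RCLike.re (h j)
    rw [← integral_re (hi j)] at this
    simpa [RCLike.smul_re] using this)
  have him := ae_eq_zero_of_integral_hartley_eq_zero_real hL hf.im (fun j => by
    have := congrArg RCLike.im (h j)
    rw [← integral_im (hi j)] at this
    simpa [RCLike.smul_im] using this)
  filter_upwards [hre, him] with x h1 h2
  exact RCLike.ext (by simpa using h1) (by simpa using h2)

/-! ### The Hartley basis of the square -/

/-- The product `(x, y) ↦ h_i(x) h_j(y)` of two Hartley functions, for `ξ = (i, j)`. -/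
noncomputable def hartley₂ (L : ℝ) (ξ : ℤ × ℤ) (p : ℝ × ℝ) : ℝ :=
  hartley L ξ.1 p.1 * hartley L ξ.2 p.2

theorem contDiff_hartley₂ (L : ℝ) (ξ : ℤ × ℤ) : ContDiff ℝ ∞ (hartley₂ L ξ) :=
  ((contDiff_hartley L ξ.1).comp contDiff_fst).mul ((contDiff_hartley L ξ.2).comp contDiff_snd)

theorem squareMeasure_eq_prod (L : ℝ) : squareMeasure L =
    (volume.restrict (Ioo 0 L)).prod (volume.restrict (Ioo 0 L)) := by
  rw [squareMeasure, openSquare, Measure.volume_eq_prod, Measure.prod_restrict]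

/-- The Hartley coefficient `∫_Ω h_ξ f` of a function `f` on the square. -/
noncomputable def hartleyCoeff {𝕜 : Type*} [RCLike 𝕜] (L : ℝ) (f : ℝ × ℝ → 𝕜) (ξ : ℤ × ℤ) : 𝕜 :=
  ∫ p, hartley₂ L ξ p • f p ∂squareMeasure L

section Coefficients

variable {𝕜 : Type*} [RCLike 𝕜] {L : ℝ}

theorem hartleyCoeff_congr_ae {f g : ℝ × ℝ → 𝕜} (h : f =ᵐ[squareMeasure L] g) :
    hartleyCoeff L f = hartleyCoeff L g := by
  funext ξ
  refine integral_congr_ae ?_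
  filter_upwards [h] with p hp
  rw [hp]

theorem memLp_squareMeasure_of_continuous {f : ℝ × ℝ → 𝕜} (hf : Continuous f) :
    MemLp f 2 (squareMeasure L) := by
  have hK : IsCompact (Icc (0 : ℝ) L ×ˢ Icc (0 : ℝ) L) := isCompact_Icc.prod isCompact_Icc
  obtain ⟨C, hC⟩ := hK.exists_bound_of_continuousOn hf.continuousOn
  refine MemLp.of_bound hf.aestronglyMeasurable C ?_
  refine ae_restrict_of_forall_mem (isOpen_openSquare L).measurableSet ?_
  intro p hp
  exact hC p ⟨Ioo_subset_Icc_self hp.1, Ioo_subset_Icc_self hp.2⟩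

theorem integrable_squareMeasure_of_continuous {f : ℝ × ℝ → 𝕜} (hf : Continuous f) :
    Integrable f (squareMeasure L) :=
  (memLp_squareMeasure_of_continuous hf).integrable (by norm_num)

theorem continuous_ofReal_hartley₂ (L : ℝ) (ξ : ℤ × ℤ) :
    Continuous (fun p => (hartley₂ L ξ p : 𝕜)) :=
  RCLike.continuous_ofReal.comp (contDiff_hartley₂ L ξ).continuous

variable (𝕜 L) in
/-- The function `h_ξ` as an element of `L²(Ω)`. -/
noncomputable def hartleyVec (ξ : ℤ × ℤ) : SquareL2 𝕜 L :=
  (memLp_squareMeasure_of_continuous (continuous_ofReal_hartley₂ L ξ)).toLp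
    (fun p => (hartley₂ L ξ p : 𝕜))

theorem coeFn_hartleyVec (ξ : ℤ × ℤ) :
    hartleyVec 𝕜 L ξ =ᵐ[squareMeasure L] fun p => (hartley₂ L ξ p : 𝕜) :=
  MemLp.coeFn_toLp _

theorem inner_hartleyVec (ξ : ℤ × ℤ) (u : SquareL2 𝕜 L) :
    inner 𝕜 (hartleyVec 𝕜 L ξ) u = hartleyCoeff L u ξ := by
  rw [L2.inner_def]
  refine integral_congr_ae ?_
  filter_upwards [coeFn_hartleyVec (𝕜 := 𝕜) (L := L) ξ] with p hp
  rw [hp, RCLike.inner_apply, RCLike.conj_ofReal, RCLike.real_smul_eq_coe_mul, mul_comm]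

theorem orthonormal_hartleyVec (hL : 0 < L) : Orthonormal 𝕜 (hartleyVec 𝕜 L) := by
  rw [orthonormal_iff_ite]
  intro ξ η
  rw [inner_hartleyVec, hartleyCoeff_congr_ae (coeFn_hartleyVec η), hartleyCoeff]
  have e : ∀ p, hartley₂ L ξ p • (hartley₂ L η p : 𝕜) =
      (((hartley L ξ.1 p.1 * hartley L η.1 p.1) * (hartley L ξ.2 p.2 * hartley L η.2 p.2) : ℝ)
        : 𝕜) := by
    intro p
    rw [RCLike.real_smul_eq_coe_mul, ← RCLike.ofReal_mul]
    congr 1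
    simp only [hartley₂]; ring
  simp only [e]
  rw [integral_ofReal, squareMeasure_eq_prod,
    integral_prod_mul (fun x => hartley L ξ.1 x * hartley L η.1 x)
      (fun x => hartley L ξ.2 x * hartley L η.2 x), integral_hartley_mul hL,
    integral_hartley_mul hL]
  by_cases h1 : ξ.1 = η.1 <;> by_cases h2 : ξ.2 = η.2 <;> simp [h1, h2, Prod.ext_iff]

/-- The Cauchy-Schwarz inequality on an interval of length `L`. -/
theorem sq_integral_norm_le (hL : 0 ≤ L) {f : ℝ → 𝕜}
    (hf : MemLp f 2 (volume.restrict (Ioo 0 L))) :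
    (∫ y in Ioo 0 L, ‖f y‖) ^ 2 ≤ L * ∫ y in Ioo 0 L, ‖f y‖ ^ 2 := by
  have hone : MemLp (fun _ : ℝ => (1 : ℝ)) (ENNReal.ofReal 2) (volume.restrict (Ioo 0 L)) :=
    memLp_const _
  have hn : MemLp (fun y => ‖f y‖) (ENNReal.ofReal 2) (volume.restrict (Ioo 0 L)) := by
    simpa using hf.norm
  have h := integral_mul_le_Lp_mul_Lq_of_nonneg Real.HolderConjugate.two_two
    (Eventually.of_forall fun _ => zero_le_one) (Eventually.of_forall fun y => norm_nonneg _)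
    hone hn
  have h2 := pow_le_pow_left₀ (integral_nonneg fun y => by positivity) h 2
  rw [mul_pow, ← Real.rpow_mul_natCast (integral_nonneg fun y => by positivity),
    ← Real.rpow_mul_natCast (integral_nonneg fun y => by positivity)] at h2
  simpa [hL] using h2

/-- Completeness of the Hartley functions on the square, from the one-dimensional statement in
each variable by Fubini's theorem. -/
theorem ae_eq_zero_of_hartleyCoeff_eq_zero (hL : 0 < L) {u : ℝ × ℝ → 𝕜}
    (hu : MemLp u 2 (squareMeasure L)) (h : ∀ ξ, hartleyCoeff L u ξ = 0) :
    u =ᵐ[squareMeasure L] 0 := by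
  have hint : ∀ ξ, Integrable (fun p => hartley₂ L ξ p • u p) (squareMeasure L) := by
    intro ξ
    refine (integrable_smul_squareL2 (contDiff_hartley₂ L ξ).continuous (hu.toLp u)).congr ?_
    filter_upwards [hu.coeFn_toLp] with p hp
    rw [hp]
  simp only [hartleyCoeff, squareMeasure_eq_prod] at hu h hint ⊢
  set ν : Measure ℝ := volume.restrict (Ioo 0 L) with hν
  have hsq : Integrable (fun p => ‖u p‖ ^ 2) (ν.prod ν) := hu.integrable_norm_pow (by norm_num)
  have hmeas := hu.aestronglyMeasurable
  -- the slices of `u` are square integrable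
  have hslice : ∀ᵐ x ∂ν, MemLp (fun y => u (x, y)) 2 ν := by
    filter_upwards [hsq.prod_right_ae, hmeas.prodMk_left] with x h1 h2
    exact (memLp_two_iff_integrable_sq_norm h2).2 h1
  have hbound : ∀ j : ℤ, ∃ C, ∀ y ∈ Ioo 0 L, ‖hartley L j y‖ ≤ C := by
    intro j
    obtain ⟨C, hC⟩ := isCompact_Icc.exists_bound_of_continuousOn
      (contDiff_hartley L j).continuous.continuousOn (s := Icc 0 L)
    exact ⟨C, fun y hy => hC y (Ioo_subset_Icc_self hy)⟩
  have hcoef : ∀ j, (fun x => ∫ y, hartley L j y • u (x, y) ∂ν) =ᵐ[ν] 0 := by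
    intro j
    obtain ⟨C, hC⟩ := hbound j
    have hm : AEStronglyMeasurable (fun p : ℝ × ℝ => hartley L j p.2 • u p) (ν.prod ν) :=
      ((contDiff_hartley L j).continuous.comp continuous_snd).aestronglyMeasurable.smul hmeas
    have hC' : ∀ᵐ y ∂ν, ‖hartley L j y‖ ≤ C := ae_restrict_of_forall_mem measurableSet_Ioo hC
    refine ae_eq_zero_of_integral_hartley_eq_zero hL ?_ ?_
    · have hint : Integrable (fun x => C ^ 2 * L * ∫ y, ‖u (x, y)‖ ^ 2 ∂ν) ν :=
        hsq.integral_prod_left.const_mul _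
      refine (memLp_two_iff_integrable_sq_norm hm.integral_prod_right').2 ?_
      refine hint.mono' (hm.integral_prod_right'.norm.pow 2) ?_
      filter_upwards [hslice] with x hx
      rw [Real.norm_of_nonneg (by positivity)]
      have hx1 : MemLp (fun y => C * ‖u (x, y)‖) 2 ν := hx.norm.const_mul C
      have h1 : ‖∫ y, hartley L j y • u (x, y) ∂ν‖ ≤ ∫ y, C * ‖u (x, y)‖ ∂ν := by
        refine norm_integral_le_of_norm_le (hx1.integrable (by norm_num)) ?_
        filter_upwards [hC'] with y hy
        rw [norm_smul]
        gcongr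
      have h2 : (∫ y, ‖u (x, y)‖ ∂ν) ^ 2 ≤ L * ∫ y, ‖u (x, y)‖ ^ 2 ∂ν :=
        sq_integral_norm_le hL.le hx
      rw [integral_const_mul] at h1
      calc ‖∫ y, hartley L j y • u (x, y) ∂ν‖ ^ 2
          ≤ (C * ∫ y, ‖u (x, y)‖ ∂ν) ^ 2 := by gcongr
        _ = C ^ 2 * (∫ y, ‖u (x, y)‖ ∂ν) ^ 2 := by ring
        _ ≤ C ^ 2 * (L * ∫ y, ‖u (x, y)‖ ^ 2 ∂ν) := by gcongr
        _ = _ := by ring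
    · intro i
      rw [← h (i, j), integral_prod _ (hint (i, j))]
      refine integral_congr_ae (Eventually.of_forall fun x => ?_)
      simp only [hartley₂, mul_smul]
      rw [integral_smul]
  have hae : ∀ᵐ x ∂ν, ∀ j, ∫ y, hartley L j y • u (x, y) ∂ν = 0 := ae_all_iff.2 hcoef
  have hfin : ∀ᵐ x ∂ν, ∀ᵐ y ∂ν, u (x, y) = 0 := by
    filter_upwards [hae, hslice] with x h1 h2
    exact ae_eq_zero_of_integral_hartley_eq_zero hL h2 h1
  have hzero : ∫ p, ‖u p‖ ^ 2 ∂ν.prod ν = 0 := by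
    rw [integral_prod _ hsq]
    refine integral_eq_zero_of_ae ?_
    filter_upwards [hfin] with x hx
    refine integral_eq_zero_of_ae ?_
    filter_upwards [hx] with y hy
    simp [hy]
  rw [integral_eq_zero_iff_of_nonneg (fun p => by positivity) hsq] at hzero
  filter_upwards [hzero] with p hp
  simpa using hp

variable (𝕜) in
/-- The Hilbert basis of `L²(Ω)` formed by the functions `h_ξ`, `ξ ∈ ℤ²`. -/
noncomputable def hartleyBasis (hL : 0 < L) : HilbertBasis (ℤ × ℤ) 𝕜 (SquareL2 𝕜 L) :=
  HilbertBasis.mkOfOrthogonalEqBot (orthonormal_hartleyVec hL) <| by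
    refine (Submodule.eq_bot_iff _).2 fun u hu => (Lp.eq_zero_iff_ae_eq_zero).2 <|
      ae_eq_zero_of_hartleyCoeff_eq_zero hL (Lp.memLp u) fun ξ => ?_
    rw [← inner_hartleyVec]
    exact (Submodule.mem_orthogonal _ _).1 hu _ (Submodule.subset_span (mem_range_self ξ))

theorem hartleyBasis_apply (hL : 0 < L) (ξ : ℤ × ℤ) :
    hartleyBasis 𝕜 hL ξ = hartleyVec 𝕜 L ξ := by
  rw [hartleyBasis, HilbertBasis.coe_mkOfOrthogonalEqBot]

theorem hartleyBasis_repr (hL : 0 < L) (u : SquareL2 𝕜 L) (ξ : ℤ × ℤ) :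
    (hartleyBasis 𝕜 hL).repr u ξ = hartleyCoeff L u ξ := by
  rw [HilbertBasis.repr_apply_apply, hartleyBasis_apply, inner_hartleyVec]

/-- Parseval's identity. -/
theorem hasSum_sq_hartleyCoeff (hL : 0 < L) (u : SquareL2 𝕜 L) :
    HasSum (fun ξ => ‖hartleyCoeff L u ξ‖ ^ 2) (‖u‖ ^ 2) := by
  have h := lp.hasSum_norm (p := 2) (by norm_num) ((hartleyBasis 𝕜 hL).repr u)
  simp only [LinearIsometryEquiv.norm_map, hartleyBasis_repr, ENNReal.toReal_ofNat] at h
  exact_mod_cast h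

theorem hasSum_hartleyCoeff_smul (hL : 0 < L) (u : SquareL2 𝕜 L) :
    HasSum (fun ξ => hartleyCoeff L u ξ • hartleyVec 𝕜 L ξ) u := by
  have h := (hartleyBasis 𝕜 hL).hasSum_repr u
  simpa only [hartleyBasis_repr, hartleyBasis_apply] using h

theorem ext_hartleyCoeff (hL : 0 < L) {u v : SquareL2 𝕜 L}
    (h : hartleyCoeff L u = hartleyCoeff L v) : u = v := by
  refine (hartleyBasis 𝕜 hL).repr.injective (lp.ext (funext fun ξ => ?_))
  rw [hartleyBasis_repr, hartleyBasis_repr, h]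

/-- The Riesz-Fischer theorem. -/
theorem exists_hartleyCoeff_eq (hL : 0 < L) {c : ℤ × ℤ → 𝕜} (hc : Summable fun ξ => ‖c ξ‖ ^ 2) :
    ∃ u : SquareL2 𝕜 L, hartleyCoeff L u = c := by
  have hm : Memℓp c 2 := memℓp_gen (by simpa using hc)
  refine ⟨(hartleyBasis 𝕜 hL).repr.symm ⟨c, hm⟩, funext fun ξ => ?_⟩
  rw [← hartleyBasis_repr hL, LinearIsometryEquiv.apply_symm_apply]

theorem hartleyCoeff_add (u v : SquareL2 𝕜 L) :
    hartleyCoeff L (u + v : SquareL2 𝕜 L) = hartleyCoeff L u + hartleyCoeff L v := by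
  funext ξ
  simp only [Pi.add_apply, ← inner_hartleyVec, inner_add_right]

theorem hartleyCoeff_neg (u : SquareL2 𝕜 L) :
    hartleyCoeff L (-u : SquareL2 𝕜 L) = -hartleyCoeff L u := by
  funext ξ
  simp only [Pi.neg_apply, ← inner_hartleyVec, inner_neg_right]

/-- The polarized Parseval identity for the pairing with a real function. -/
theorem tsum_hartleyCoeff_smul (hL : 0 < L) {φ : ℝ × ℝ → ℝ} (hφ : Continuous φ)
    (u : SquareL2 𝕜 L) :
    ∑' ξ, hartleyCoeff L φ ξ • hartleyCoeff L u ξ = ∫ p, φ p • u p ∂squareMeasure L := by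
  have hΦ : MemLp (fun p => (φ p : 𝕜)) 2 (squareMeasure L) :=
    memLp_squareMeasure_of_continuous (RCLike.continuous_ofReal.comp hφ)
  have hcoe := hΦ.coeFn_toLp
  have h := (hartleyBasis 𝕜 hL).tsum_inner_mul_inner (hΦ.toLp _) u
  have e : ∀ ξ, hartleyCoeff L (hΦ.toLp _) ξ = ((hartleyCoeff L φ ξ : ℝ) : 𝕜) := by
    intro ξ
    rw [hartleyCoeff_congr_ae hcoe, hartleyCoeff, hartleyCoeff, ← integral_ofReal]
    refine integral_congr_ae (Eventually.of_forall fun p => ?_)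
    simp [RCLike.real_smul_eq_coe_mul]
  rw [L2.inner_def] at h
  have e2 : ∫ p, inner 𝕜 (hΦ.toLp (fun p => (φ p : 𝕜)) p) (u p) ∂squareMeasure L =
      ∫ p, φ p • u p ∂squareMeasure L := by
    refine integral_congr_ae ?_
    filter_upwards [hcoe] with p hp
    rw [hp, RCLike.inner_apply, RCLike.conj_ofReal, RCLike.real_smul_eq_coe_mul, mul_comm]
  rw [← e2, ← h]
  refine tsum_congr fun ξ => ?_
  rw [hartleyBasis_apply, ← inner_conj_symm (hΦ.toLp _), inner_hartleyVec, inner_hartleyVec, e,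
    RCLike.conj_ofReal, RCLike.real_smul_eq_coe_mul]

end Coefficients

/-! ### Derivatives and Hartley coefficients -/

/-- The action of `∂/∂x` on Hartley coefficients of periodic functions. -/
noncomputable def coeffX {E : Type*} [AddCommGroup E] [Module ℝ E] (L : ℝ) (c : ℤ × ℤ → E) :
    ℤ × ℤ → E :=
  fun ξ => -(freq L ξ.1 • c (-ξ.1, ξ.2))

/-- The action of `∂/∂y` on Hartley coefficients of periodic functions. -/
noncomputable def coeffY {E : Type*} [AddCommGroup E] [Module ℝ E] (L : ℝ) (c : ℤ × ℤ → E) :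
    ℤ × ℤ → E :=
  fun ξ => -(freq L ξ.2 • c (ξ.1, -ξ.2))

/-- The action of `D^α` on Hartley coefficients of periodic functions. -/
noncomputable def coeffDeriv {E : Type*} [AddCommGroup E] [Module ℝ E] (L : ℝ) (α : ℕ × ℕ)
    (c : ℤ × ℤ → E) : ℤ × ℤ → E :=
  (coeffX L)^[α.1] ((coeffY L)^[α.2] c)

section Sequences

variable {E : Type*} [AddCommGroup E] [Module ℝ E] {L : ℝ}

theorem commute_coeffX_coeffY :
    Function.Commute (coeffX L : (ℤ × ℤ → E) → ℤ × ℤ → E) (coeffY L) := by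
  intro c
  funext ξ
  simp only [coeffX, coeffY, smul_neg, neg_neg]
  rw [smul_comm]

theorem coeffY_coeffDeriv (α : ℕ × ℕ) (c : ℤ × ℤ → E) :
    coeffY L (coeffDeriv L α c) = coeffDeriv L (α.1, α.2 + 1) c := by
  rw [coeffDeriv, coeffDeriv, ← (commute_coeffX_coeffY (E := E) (L := L)).iterate_left α.1,
    Function.iterate_succ_apply']

theorem coeffX_coeffDeriv (α : ℕ × ℕ) (c : ℤ × ℤ → E) :
    coeffX L (coeffDeriv L α c) = coeffDeriv L (α.1 + 1, α.2) c := by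
  rw [coeffDeriv, coeffDeriv, Function.iterate_succ_apply']

theorem coeffX_coeffX (c : ℤ × ℤ → E) (ξ : ℤ × ℤ) :
    coeffX L (coeffX L c) ξ = -(freq L ξ.1 ^ 2 • c ξ) := by
  simp only [coeffX, freq_neg, neg_smul, neg_neg, smul_smul, pow_two]

theorem coeffY_coeffY (c : ℤ × ℤ → E) (ξ : ℤ × ℤ) :
    coeffY L (coeffY L c) ξ = -(freq L ξ.2 ^ 2 • c ξ) := by
  simp only [coeffY, freq_neg, neg_smul, neg_neg, smul_smul, pow_two]

/-- The reflection of `ℤ²` in the first coordinate. -/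
def reflX : ℤ × ℤ ≃ ℤ × ℤ := (Equiv.neg ℤ).prodCongr (Equiv.refl ℤ)

/-- The reflection of `ℤ²` in the second coordinate. -/
def reflY : ℤ × ℤ ≃ ℤ × ℤ := (Equiv.refl ℤ).prodCongr (Equiv.neg ℤ)

end Sequences

section Pairing

variable {E : Type*} [NormedAddCommGroup E] [NormedSpace ℝ E] {L : ℝ}

theorem tsum_coeffX_smul (a : ℤ × ℤ → ℝ) (c : ℤ × ℤ → E) :
    ∑' ξ, coeffX L a ξ • c ξ = -∑' ξ, a ξ • coeffX L c ξ := by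
  rw [← tsum_neg, ← reflX.tsum_eq]
  refine tsum_congr fun ξ => ?_
  simp only [reflX, coeffX, Equiv.prodCongr_apply, Prod.map, Equiv.neg_apply, Equiv.refl_apply,
    freq_neg, neg_neg, smul_neg, smul_smul, neg_smul, smul_eq_mul]
  simp [mul_comm]

theorem tsum_coeffY_smul (a : ℤ × ℤ → ℝ) (c : ℤ × ℤ → E) :
    ∑' ξ, coeffY L a ξ • c ξ = -∑' ξ, a ξ • coeffY L c ξ := by
  rw [← tsum_neg, ← reflY.tsum_eq]
  refine tsum_congr fun ξ => ?_
  simp only [reflY, coeffY, Equiv.prodCongr_apply, Prod.map, Equiv.neg_apply, Equiv.refl_apply,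
    freq_neg, neg_neg, smul_neg, smul_smul, neg_smul, smul_eq_mul]
  simp [mul_comm]

/-- `D^α` is formally self-adjoint up to the sign `(-1)^|α|` on Hartley coefficients. The identity
is a reindexing of the sum by reflections, so no summability is needed. -/
theorem tsum_coeffDeriv_smul (α : ℕ × ℕ) (a : ℤ × ℤ → ℝ) (c : ℤ × ℤ → E) :
    ∑' ξ, coeffDeriv L α a ξ • c ξ = (-1 : ℝ) ^ (α.1 + α.2) • ∑' ξ, a ξ • coeffDeriv L α c ξ := by
  obtain ⟨m, n⟩ := α
  induction m generalizing c with
  | zero =>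
    induction n generalizing c with
    | zero => simp [coeffDeriv]
    | succ n ih =>
      have h1 := coeffY_coeffDeriv (L := L) (0, n) a
      have h2 : coeffDeriv L (0, n) (coeffY L c) = coeffDeriv L (0, n + 1) c := rfl
      dsimp only at h1
      rw [← h1, tsum_coeffY_smul, ih, h2]
      simp only [zero_add, pow_succ, mul_neg, mul_one, neg_smul]
  | succ m ih =>
    have h1 := coeffX_coeffDeriv (L := L) (m, n) a
    have h2 : coeffDeriv L (m, n) (coeffX L c) = coeffDeriv L (m + 1, n) c := by
      rw [coeffDeriv, coeffDeriv,
        ← (commute_coeffX_coeffY (E := E) (L := L)).iterate_right n c,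
        ← Function.iterate_succ_apply]
    dsimp only at h1
    rw [← h1, tsum_coeffX_smul, ih, h2]
    simp only [add_right_comm m 1 n, pow_succ _ (m + n), mul_neg, mul_one, neg_smul]

end Pairing

section Derivatives

variable {𝕜 : Type*} [RCLike 𝕜] {L : ℝ}

theorem hartleyCoeff_comp_swap (f : ℝ × ℝ → 𝕜) (ξ : ℤ × ℤ) :
    hartleyCoeff L (f ∘ Prod.swap) ξ = hartleyCoeff L f ξ.swap := by
  rw [hartleyCoeff, hartleyCoeff, squareMeasure_eq_prod,
    ← integral_prod_swap (fun p => hartley₂ L ξ.swap p • f p)]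
  refine integral_congr_ae (Eventually.of_forall fun p => ?_)
  simp only [hartley₂, Function.comp, Prod.fst_swap, Prod.snd_swap, mul_comm]

theorem partialX_comp_swap (f : ℝ × ℝ → 𝕜) :
    partialX (f ∘ Prod.swap) = partialY f ∘ Prod.swap := rfl

theorem contDiff_comp_swap {f : ℝ × ℝ → 𝕜} (hf : ContDiff ℝ ∞ f) :
    ContDiff ℝ ∞ (f ∘ Prod.swap) :=
  hf.comp (contDiff_snd.prodMk contDiff_fst)

theorem hasDerivAt_partialX {f : ℝ × ℝ → 𝕜} (hf : ContDiff ℝ ∞ f) (x y : ℝ) :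
    HasDerivAt (fun t => f (t, y)) (partialX f (x, y)) x :=
  ((hf.comp (contDiff_id.prodMk contDiff_const)).differentiable (by simp) x).hasDerivAt

/-- Integration by parts in `x`: the jump of `f` across the square enters as a boundary term. -/
theorem hartleyCoeff_partialX (hL : 0 < L) {f : ℝ × ℝ → 𝕜} (hf : ContDiff ℝ ∞ f) (ξ : ℤ × ℤ) :
    hartleyCoeff L (partialX f) ξ =
      (∫ y in Ioo 0 L, (hartley L ξ.1 0 * hartley L ξ.2 y) • (f (L, y) - f (0, y))) +
        coeffX L (hartleyCoeff L f) ξ := by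
  have hcont : ∀ (η : ℤ × ℤ) {g : ℝ × ℝ → 𝕜}, Continuous g →
      Integrable (fun p => hartley₂ L η p • g p)
        ((volume.restrict (Ioo 0 L)).prod (volume.restrict (Ioo 0 L))) := by
    intro η g hg
    rw [← squareMeasure_eq_prod]
    exact integrable_squareMeasure_of_continuous ((contDiff_hartley₂ L η).continuous.smul hg)
  have hfx := (contDiff_partialX hf).continuous
  have h1 := hcont ξ hfx
  have h2 := hcont (-ξ.1, ξ.2) hf.continuous
  have hinner : ∀ y, ∫ x in Ioo 0 L, hartley₂ L ξ (x, y) • partialX f (x, y) =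
      (hartley L ξ.1 0 * hartley L ξ.2 y) • (f (L, y) - f (0, y)) -
        freq L ξ.1 • ∫ x in Ioo 0 L, hartley₂ L (-ξ.1, ξ.2) (x, y) • f (x, y) := by
    intro y
    have ibp := intervalIntegral.integral_smul_deriv_eq_deriv_smul (a := 0) (b := L)
      (u := fun x => hartley₂ L ξ (x, y)) (v := fun x => f (x, y))
      (u' := fun x => freq L ξ.1 * hartley₂ L (-ξ.1, ξ.2) (x, y))
      (v' := fun x => partialX f (x, y))
      (fun x _ => by
        have := (hasDerivAt_hartley L ξ.1 x).mul_const (hartley L ξ.2 y)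
        simpa only [hartley₂, mul_assoc] using this)
      (fun x _ => hasDerivAt_partialX hf x y)
      ((continuous_const.mul ((contDiff_hartley₂ L _).continuous.comp
        (continuous_id.prodMk continuous_const))).intervalIntegrable _ _)
      ((hfx.comp (continuous_id.prodMk continuous_const)).intervalIntegrable _ _)
    rw [intervalIntegral.integral_of_le hL.le, intervalIntegral.integral_of_le hL.le,
      integral_Ioc_eq_integral_Ioo, integral_Ioc_eq_integral_Ioo] at ibp
    rw [ibp]
    simp only [mul_smul, integral_smul, hartley₂, hartley_period hL, smul_sub]
  rw [hartleyCoeff, squareMeasure_eq_prod, integral_prod_symm _ h1]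
  simp only [hinner]
  have hb : Continuous fun y => (hartley L ξ.1 0 * hartley L ξ.2 y) • (f (L, y) - f (0, y)) :=
    (continuous_const.mul (contDiff_hartley L ξ.2).continuous).smul
      ((hf.continuous.comp (continuous_const.prodMk continuous_id)).sub
        (hf.continuous.comp (continuous_const.prodMk continuous_id)))
  have h3 : Integrable (fun y => freq L ξ.1 • ∫ x in Ioo 0 L,
      hartley₂ L (-ξ.1, ξ.2) (x, y) • f (x, y)) (volume.restrict (Ioo 0 L)) :=
    h2.integral_prod_right.fun_smul _
  rw [integral_sub (hb.integrableOn_Icc.mono_set Ioo_subset_Icc_self) h3, integral_smul,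
    ← integral_prod_symm _ h2, ← squareMeasure_eq_prod, sub_eq_add_neg]
  rfl

theorem hartleyCoeff_partialY (hL : 0 < L) {f : ℝ × ℝ → 𝕜} (hf : ContDiff ℝ ∞ f) (ξ : ℤ × ℤ) :
    hartleyCoeff L (partialY f) ξ =
      (∫ x in Ioo 0 L, (hartley L ξ.2 0 * hartley L ξ.1 x) • (f (x, L) - f (x, 0))) +
        coeffY L (hartleyCoeff L f) ξ := by
  have h := hartleyCoeff_partialX hL (contDiff_comp_swap hf) ξ.swap
  rw [partialX_comp_swap, hartleyCoeff_comp_swap, Prod.swap_swap] at h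
  rw [h]
  simp only [coeffX, coeffY, hartleyCoeff_comp_swap]
  rfl

theorem support_partialX_subset {f : ℝ × ℝ → ℝ} : Function.support (partialX f) ⊆ tsupport f := by
  intro p hp
  by_contra h
  refine hp ?_
  have h0 : f =ᶠ[𝓝 p] 0 := notMem_tsupport_iff_eventuallyEq.1 h
  have hc : Tendsto (fun t : ℝ => (t, p.2)) (𝓝 p.1) (𝓝 p) :=
    (continuous_id.prodMk continuous_const).tendsto' _ _ rfl
  have h1 : (fun t => f (t, p.2)) =ᶠ[𝓝 p.1] fun _ => 0 := hc.eventually h0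
  rw [partialX, h1.deriv_eq, deriv_const]

theorem support_partialY_subset {f : ℝ × ℝ → ℝ} : Function.support (partialY f) ⊆ tsupport f := by
  intro p hp
  by_contra h
  refine hp ?_
  have h0 : f =ᶠ[𝓝 p] 0 := notMem_tsupport_iff_eventuallyEq.1 h
  have hc : Tendsto (fun t : ℝ => (p.1, t)) (𝓝 p.2) (𝓝 p) :=
    (continuous_const.prodMk continuous_id).tendsto' _ _ rfl
  have h1 : (fun t => f (p.1, t)) =ᶠ[𝓝 p.2] fun _ => 0 := hc.eventually h0
  rw [partialY, h1.deriv_eq, deriv_const]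

theorem IsSquareTest.partialX {φ : ℝ × ℝ → ℝ} (hφ : IsSquareTest L φ) :
    IsSquareTest L (partialX φ) where
  smooth := contDiff_partialX hφ.smooth
  compact := hφ.compact.mono' support_partialX_subset
  support := (closure_minimal support_partialX_subset (isClosed_tsupport φ)).trans hφ.support

theorem IsSquareTest.partialY {φ : ℝ × ℝ → ℝ} (hφ : IsSquareTest L φ) :
    IsSquareTest L (partialY φ) where
  smooth := contDiff_partialY hφ.smooth
  compact := hφ.compact.mono' support_partialY_subset
  support := (closure_minimal support_partialY_subset (isClosed_tsupport φ)).trans hφ.support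

theorem IsSquareTest.eq_zero {φ : ℝ × ℝ → ℝ} (hφ : IsSquareTest L φ) {p : ℝ × ℝ}
    (hp : p ∉ openSquare L) : φ p = 0 :=
  image_eq_zero_of_notMem_tsupport fun h => hp (hφ.support h)

theorem IsSquareTest.hartleyCoeff_partialX (hL : 0 < L) {φ : ℝ × ℝ → ℝ}
    (hφ : IsSquareTest L φ) :
    hartleyCoeff L (_root_.partialX φ) = coeffX L (hartleyCoeff L φ) := by
  funext ξ
  have h0 : ∀ y, φ (0, y) = 0 := fun y => hφ.eq_zero fun h => lt_irrefl _ h.1.1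
  have h1 : ∀ y, φ (L, y) = 0 := fun y => hφ.eq_zero fun h => lt_irrefl _ h.1.2
  rw [_root_.hartleyCoeff_partialX hL hφ.smooth]
  simp [h0, h1]

theorem IsSquareTest.hartleyCoeff_partialY (hL : 0 < L) {φ : ℝ × ℝ → ℝ}
    (hφ : IsSquareTest L φ) :
    hartleyCoeff L (_root_.partialY φ) = coeffY L (hartleyCoeff L φ) := by
  funext ξ
  have h0 : ∀ x, φ (x, 0) = 0 := fun y => hφ.eq_zero fun h => lt_irrefl _ h.2.1
  have h1 : ∀ x, φ (x, L) = 0 := fun y => hφ.eq_zero fun h => lt_irrefl _ h.2.2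
  rw [_root_.hartleyCoeff_partialY hL hφ.smooth]
  simp [h0, h1]

theorem IsSquareTest.hartleyCoeff_iteratedPartial (hL : 0 < L) {φ : ℝ × ℝ → ℝ}
    (hφ : IsSquareTest L φ) (α : ℕ × ℕ) :
    hartleyCoeff L (iteratedPartial α φ) = coeffDeriv L α (hartleyCoeff L φ) := by
  have hy : ∀ n, IsSquareTest L (_root_.partialY^[n] φ) ∧
      hartleyCoeff L (_root_.partialY^[n] φ) = (coeffY L)^[n] (hartleyCoeff L φ) := by
    intro n
    induction n with
    | zero => exact ⟨hφ, rfl⟩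
    | succ n ih =>
      rw [Function.iterate_succ_apply', Function.iterate_succ_apply',
        ih.1.hartleyCoeff_partialY hL, ih.2]
      exact ⟨ih.1.partialY, rfl⟩
  have hx : ∀ n, IsSquareTest L (_root_.partialX^[n] (_root_.partialY^[α.2] φ)) ∧
      hartleyCoeff L (_root_.partialX^[n] (_root_.partialY^[α.2] φ)) =
        (coeffX L)^[n] ((coeffY L)^[α.2] (hartleyCoeff L φ)) := by
    intro n
    induction n with
    | zero => exact hy α.2
    | succ n ih =>
      rw [Function.iterate_succ_apply', Function.iterate_succ_apply',
        ih.1.hartleyCoeff_partialX hL, ih.2]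
      exact ⟨ih.1.partialX, rfl⟩
  exact (hx α.1).2

/-- Term-by-term differentiation of a Hartley series gives the weak derivative. -/
theorem isWeakDeriv_of_hartleyCoeff (hL : 0 < L) {α : ℕ × ℕ} {u v : SquareL2 𝕜 L}
    (h : hartleyCoeff L v = coeffDeriv L α (hartleyCoeff L u)) : IsWeakDeriv α u v := by
  intro φ hφ
  rw [← tsum_hartleyCoeff_smul hL (contDiff_iteratedPartial hφ.smooth α).continuous,
    ← tsum_hartleyCoeff_smul hL hφ.smooth.continuous, h, hφ.hartleyCoeff_iteratedPartial hL,
    tsum_coeffDeriv_smul]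

end Derivatives

/-! ### Traces and boundary jumps -/

section Limits

variable {𝕜 : Type*} [RCLike 𝕜]

theorem tendsto_integral_smul_of_tendsto_eLpNorm {X : Type*} [MeasurableSpace X] {μ : Measure X}
    {h : X → ℝ} (hh : MemLp h 2 μ) {f : ℕ → X → 𝕜} {g : X → 𝕜} (hf : ∀ n, MemLp (f n) 2 μ)
    (hg : MemLp g 2 μ) (ht : Tendsto (fun n => eLpNorm (f n - g) 2 μ) atTop (𝓝 0)) :
    Tendsto (fun n => ∫ x, h x • f n x ∂μ) atTop (𝓝 (∫ x, h x • g x ∂μ)) := by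
  have hint : ∀ {k : X → 𝕜}, MemLp k 2 μ → Integrable (fun x => h x • k x) μ := fun hk =>
    memLp_one_iff_integrable.1 (MemLp.smul (p := 2) (q := 2) (r := 1) hk hh)
  have hs : Tendsto (fun n => eLpNorm h 2 μ * eLpNorm (f n - g) 2 μ) atTop (𝓝 0) := by
    simpa using ENNReal.Tendsto.const_mul ht (Or.inr hh.2.ne)
  refine tendsto_integral_of_L1' _ (hint hg).1 (Eventually.of_forall fun n => hint (hf n)) ?_
  refine tendsto_of_tendsto_of_tendsto_of_le_of_le tendsto_const_nhds hs (fun _ => zero_le) ?_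
  intro n
  have e : (fun x => h x • f n x) - (fun x => h x • g x) = h • (f n - g) := by
    funext x
    exact (smul_sub _ _ _).symm
  have hle := eLpNorm_smul_le_mul_eLpNorm (p := 2) (q := 2) (r := 1) ((hf n).1.sub hg.1) hh.1
  rw [← e] at hle
  exact hle

variable {L : ℝ}

theorem tendsto_hartleyCoeff {f : ℕ → ℝ × ℝ → 𝕜} (hf : ∀ n, Continuous (f n)) (u : SquareL2 𝕜 L)
    (ht : Tendsto (fun n => eLpNorm (f n - ⇑u) 2 (squareMeasure L)) atTop (𝓝 0)) (ξ : ℤ × ℤ) :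
    Tendsto (fun n => hartleyCoeff L (f n) ξ) atTop (𝓝 (hartleyCoeff L u ξ)) :=
  tendsto_integral_smul_of_tendsto_eLpNorm
    (memLp_squareMeasure_of_continuous (contDiff_hartley₂ L ξ).continuous)
    (fun n => memLp_squareMeasure_of_continuous (hf n)) (Lp.memLp u) ht

theorem memLp_interval_of_continuous {f : ℝ → 𝕜} (hf : Continuous f) :
    MemLp f 2 (volume.restrict (Ioo 0 L)) := by
  obtain ⟨C, hC⟩ := isCompact_Icc.exists_bound_of_continuousOn hf.continuousOn (s := Icc 0 L)
  exact MemLp.of_bound hf.aestronglyMeasurable C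
    (ae_restrict_of_forall_mem measurableSet_Ioo fun x hx => hC x (Ioo_subset_Icc_self hx))

/-- `a` is the arc length parametrization of a part of `∂Ω`. -/
def IsSide (L : ℝ) (a : ℝ → ℝ × ℝ) : Prop :=
  Continuous a ∧ (volume.restrict (Ioo 0 L)).map a ≤ squareBoundaryMeasure L

theorem isSide_left (L : ℝ) : IsSide L fun y => (0, y) :=
  ⟨by fun_prop, (Measure.le_add_right le_rfl).trans (Measure.le_add_right le_rfl)⟩

theorem isSide_right (L : ℝ) : IsSide L fun y => (L, y) :=
  ⟨by fun_prop, (Measure.le_add_left le_rfl).trans (Measure.le_add_right le_rfl)⟩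

theorem isSide_bottom (L : ℝ) : IsSide L fun x => (x, 0) :=
  ⟨by fun_prop, (Measure.le_add_right le_rfl).trans (Measure.le_add_left le_rfl)⟩

theorem isSide_top (L : ℝ) : IsSide L fun x => (x, L) :=
  ⟨by fun_prop, (Measure.le_add_left le_rfl).trans (Measure.le_add_left le_rfl)⟩

theorem IsSide.aestronglyMeasurable {a : ℝ → ℝ × ℝ} (ha : IsSide L a) {g : ℝ × ℝ → 𝕜}
    (hg : AEStronglyMeasurable g (squareBoundaryMeasure L)) :
    AEStronglyMeasurable (g ∘ a) (volume.restrict (Ioo 0 L)) :=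
  (hg.mono_measure ha.2).comp_aemeasurable ha.1.aemeasurable

theorem IsSide.eLpNorm_le {a : ℝ → ℝ × ℝ} (ha : IsSide L a) {g : ℝ × ℝ → 𝕜}
    (hg : AEStronglyMeasurable g (squareBoundaryMeasure L)) :
    eLpNorm (g ∘ a) 2 (volume.restrict (Ioo 0 L)) ≤ eLpNorm g 2 (squareBoundaryMeasure L) := by
  rw [← eLpNorm_map_measure (hg.mono_measure ha.2) ha.1.aemeasurable]
  exact eLpNorm_mono_measure _ ha.2

theorem tendsto_eLpNorm_jump {a b : ℝ → ℝ × ℝ} (ha : IsSide L a) (hb : IsSide L b)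
    {φ : ℕ → ℝ × ℝ → 𝕜} (hφ : ∀ n, Continuous (φ n)) {g : SquareBoundaryL2 𝕜 L}
    (h : Tendsto (fun n => eLpNorm (φ n - ⇑g) 2 (squareBoundaryMeasure L)) atTop (𝓝 0)) :
    Tendsto (fun n => eLpNorm ((φ n ∘ a - φ n ∘ b) - (g ∘ a - g ∘ b)) 2
      (volume.restrict (Ioo 0 L))) atTop (𝓝 0) := by
  have hm : ∀ n, AEStronglyMeasurable (φ n - ⇑g) (squareBoundaryMeasure L) := fun n =>
    (hφ n).aestronglyMeasurable.sub (Lp.aestronglyMeasurable g)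
  have h2 := h.add h
  rw [add_zero] at h2
  refine tendsto_of_tendsto_of_tendsto_of_le_of_le tendsto_const_nhds h2 (fun _ => zero_le)
    fun n => ?_
  have e : (φ n ∘ a - φ n ∘ b) - (g ∘ a - g ∘ b) = (φ n - ⇑g) ∘ a - (φ n - ⇑g) ∘ b := by
    funext x
    simp only [Pi.sub_apply, Function.comp]
    ring
  simp only [e]
  exact (eLpNorm_sub_le (ha.aestronglyMeasurable (hm n)) (hb.aestronglyMeasurable (hm n))
    (by norm_num)).trans (add_le_add (ha.eLpNorm_le (hm n)) (hb.eLpNorm_le (hm n)))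

/-- If the trace takes the same values on two sides, the jumps of smooth approximations vanish
in the limit. -/
theorem tendsto_integral_jump {a b : ℝ → ℝ × ℝ} (ha : IsSide L a) (hb : IsSide L b)
    {φ : ℕ → ℝ × ℝ → 𝕜} (hφ : ∀ n, Continuous (φ n)) {g : SquareBoundaryL2 𝕜 L}
    (h : Tendsto (fun n => eLpNorm (φ n - ⇑g) 2 (squareBoundaryMeasure L)) atTop (𝓝 0))
    (hg : ∀ᵐ t ∂volume.restrict (Ioo 0 L), g (a t) = g (b t)) {k : ℝ → ℝ} (hk : Continuous k) :
    Tendsto (fun n => ∫ t in Ioo 0 L, k t • (φ n (b t) - φ n (a t))) atTop (𝓝 0) := by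
  have hj := tendsto_eLpNorm_jump hb ha hφ h
  have hj' : Tendsto (fun n => eLpNorm ((φ n ∘ b - φ n ∘ a) - 0) 2
      (volume.restrict (Ioo 0 L))) atTop (𝓝 0) := by
    refine hj.congr fun n => eLpNorm_congr_ae ?_
    filter_upwards [hg] with t ht
    simp [ht]
  have := tendsto_integral_smul_of_tendsto_eLpNorm (memLp_interval_of_continuous hk)
    (fun n => memLp_interval_of_continuous
      (((hφ n).comp hb.1).sub ((hφ n).comp ha.1))) MemLp.zero hj'
  simpa using this

/-- The trace of a limit of periodic functions is periodic. -/
theorem ae_eq_of_tendsto_of_jump_eq_zero {a b : ℝ → ℝ × ℝ} (ha : IsSide L a) (hb : IsSide L b)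
    {φ : ℕ → ℝ × ℝ → 𝕜} (hφ : ∀ n, Continuous (φ n)) {g : SquareBoundaryL2 𝕜 L}
    (h : Tendsto (fun n => eLpNorm (φ n - ⇑g) 2 (squareBoundaryMeasure L)) atTop (𝓝 0))
    (hab : ∀ n t, φ n (a t) = φ n (b t)) :
    ∀ᵐ t ∂volume.restrict (Ioo 0 L), g (a t) = g (b t) := by
  have hj := tendsto_eLpNorm_jump ha hb hφ h
  have e : ∀ n, φ n ∘ a - φ n ∘ b = 0 := fun n => by funext t; simp [hab]
  simp only [e, zero_sub, eLpNorm_neg] at hj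
  have h0 := tendsto_nhds_unique tendsto_const_nhds hj
  rw [eLpNorm_eq_zero_iff ((ha.aestronglyMeasurable (Lp.aestronglyMeasurable g)).sub
    (hb.aestronglyMeasurable (Lp.aestronglyMeasurable g))) (by norm_num)] at h0
  filter_upwards [h0] with t ht
  simpa [sub_eq_zero] using ht

/-- For a function with periodic trace, integration by parts leaves no boundary term. -/
theorem TracePeriodicX.hartleyCoeff_weakDeriv (hL : 0 < L) {u : SquareL2 𝕜 L}
    (hu : TracePeriodicX u) :
    hartleyCoeff L (weakDeriv (1, 0) u) = coeffX L (hartleyCoeff L u) := by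
  obtain ⟨g, ⟨-, φ, hφ, h1, h2, -, h4⟩, hg⟩ := hu
  funext ξ
  have hl := tendsto_hartleyCoeff (fun n => (contDiff_partialX (hφ n)).continuous) _ h2 ξ
  refine tendsto_nhds_unique hl ?_
  simp only [hartleyCoeff_partialX hL (hφ _)]
  have hr := tendsto_hartleyCoeff (fun n => (hφ n).continuous) _ h1 (-ξ.1, ξ.2)
  have hj := tendsto_integral_jump (isSide_left L) (isSide_right L) (fun n => (hφ n).continuous)
    h4 hg (k := fun y => hartley L ξ.1 0 * hartley L ξ.2 y)
    (continuous_const.mul (contDiff_hartley L ξ.2).continuous)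
  simpa [coeffX] using hj.add (hr.const_smul (freq L ξ.1)).neg

theorem TracePeriodicY.hartleyCoeff_weakDeriv (hL : 0 < L) {u : SquareL2 𝕜 L}
    (hu : TracePeriodicY u) :
    hartleyCoeff L (weakDeriv (0, 1) u) = coeffY L (hartleyCoeff L u) := by
  obtain ⟨g, ⟨-, φ, hφ, h1, -, h3, h4⟩, hg⟩ := hu
  funext ξ
  have hl := tendsto_hartleyCoeff (fun n => (contDiff_partialY (hφ n)).continuous) _ h3 ξ
  refine tendsto_nhds_unique hl ?_
  simp only [hartleyCoeff_partialY hL (hφ _)]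
  have hr := tendsto_hartleyCoeff (fun n => (hφ n).continuous) _ h1 (ξ.1, -ξ.2)
  have hj := tendsto_integral_jump (isSide_bottom L) (isSide_top L) (fun n => (hφ n).continuous)
    h4 hg (k := fun x => hartley L ξ.2 0 * hartley L ξ.1 x)
    (continuous_const.mul (contDiff_hartley L ξ.1).continuous)
  simpa [coeffY] using hj.add (hr.const_smul (freq L ξ.2)).neg

end Limits

/-! ### The trace inequality -/

section TraceInequality

variable {𝕜 : Type*} [RCLike 𝕜] {L : ℝ}

/-- The value at a point is bounded by the `H¹` norm on an interval: average
`f s = f x - ∫_s^x f'` over `x`. -/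
theorem sq_norm_le_integral (hL : 0 < L) {f f' : ℝ → 𝕜} (hf : ∀ x, HasDerivAt f (f' x) x)
    (hf' : Continuous f') {s : ℝ} (hs : s ∈ Icc 0 L) :
    L * ‖f s‖ ^ 2 ≤ 2 * (∫ x in Ioo 0 L, ‖f x‖ ^ 2) +
      2 * L ^ 2 * ∫ x in Ioo 0 L, ‖f' x‖ ^ 2 := by
  have hfc : Continuous f := continuous_iff_continuousAt.2 fun x => (hf x).continuousAt
  have hint : IntegrableOn (fun x => ‖f' x‖) (Ioo 0 L) :=
    hf'.norm.integrableOn_Icc.mono_set Ioo_subset_Icc_self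
  have hpt : ∀ x ∈ Ioo 0 L, ‖f s‖ ^ 2 ≤
      2 * ‖f x‖ ^ 2 + 2 * (L * ∫ x in Ioo 0 L, ‖f' x‖ ^ 2) := by
    intro x hx
    have h1 : ∫ t in s..x, f' t = f x - f s :=
      intervalIntegral.integral_eq_sub_of_hasDerivAt (fun t _ => hf t)
        (hf'.intervalIntegrable _ _)
    have h2 : ‖f x - f s‖ ≤ ∫ t in Ioo 0 L, ‖f' t‖ := by
      rw [← h1, ← integral_Icc_eq_integral_Ioo]
      refine intervalIntegral.norm_integral_le_integral_norm_uIoc.trans ?_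
      refine setIntegral_mono_set hf'.norm.integrableOn_Icc
        (Eventually.of_forall fun _ => norm_nonneg _) (LE.le.eventuallyLE ?_)
      intro t ht
      exact uIcc_subset_Icc hs (Ioo_subset_Icc_self hx) (uIoc_subset_uIcc ht)
    have h3 := sq_integral_norm_le hL.le (memLp_interval_of_continuous (L := L) hf')
    have h4 : ‖f s‖ ≤ ‖f x‖ + ∫ t in Ioo 0 L, ‖f' t‖ := by
      have := norm_sub_norm_le (f s) (f x)
      rw [norm_sub_rev] at this
      linarith
    have h5 : 0 ≤ ∫ t in Ioo 0 L, ‖f' t‖ := integral_nonneg fun _ => norm_nonneg _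
    nlinarith [sq_nonneg (‖f x‖ - ∫ t in Ioo 0 L, ‖f' t‖), norm_nonneg (f s),
      pow_le_pow_left₀ (norm_nonneg (f s)) h4 2]
  have hi1 : IntegrableOn (fun x => ‖f x‖ ^ 2) (Ioo 0 L) :=
    (hfc.norm.pow 2).integrableOn_Icc.mono_set Ioo_subset_Icc_self
  have h := setIntegral_mono_on (s := Ioo 0 L) (μ := volume) (f := fun _ => ‖f s‖ ^ 2)
    (integrable_const _)
    ((hi1.const_mul 2).add (integrable_const (2 * (L * ∫ x in Ioo 0 L, ‖f' x‖ ^ 2))))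
    measurableSet_Ioo hpt
  simp only [Pi.add_apply] at h
  rw [integral_add (hi1.const_mul 2) (integrable_const _), integral_const_mul] at h
  simp only [integral_const, MeasurableSet.univ, measureReal_restrict_apply, univ_inter,
    Real.volume_real_Ioo_of_le hL.le, sub_zero, smul_eq_mul] at h
  linarith

theorem integral_vertical_side_le (hL : 0 < L) {f : ℝ × ℝ → 𝕜} (hf : ContDiff ℝ ∞ f) {s : ℝ}
    (hs : s ∈ Icc 0 L) :
    L * ∫ y in Ioo 0 L, ‖f (s, y)‖ ^ 2 ≤ 2 * (∫ p, ‖f p‖ ^ 2 ∂squareMeasure L) +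
      2 * L ^ 2 * ∫ p, ‖partialX f p‖ ^ 2 ∂squareMeasure L := by
  have hi : ∀ {g : ℝ × ℝ → 𝕜}, Continuous g → Integrable (fun p => ‖g p‖ ^ 2)
      ((volume.restrict (Ioo 0 L)).prod (volume.restrict (Ioo 0 L))) := by
    intro g hg
    rw [← squareMeasure_eq_prod]
    exact (memLp_squareMeasure_of_continuous hg).integrable_norm_pow (by norm_num)
  have h1 := hi hf.continuous
  have h2 := hi (contDiff_partialX hf).continuous
  have hside : IntegrableOn (fun y => ‖f (s, y)‖ ^ 2) (Ioo 0 L) :=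
    (((hf.continuous.comp (continuous_const.prodMk continuous_id)).norm.pow
      2).integrableOn_Icc).mono_set Ioo_subset_Icc_self
  rw [squareMeasure_eq_prod, integral_prod_symm _ h1, integral_prod_symm _ h2,
    ← integral_const_mul, ← integral_const_mul, ← integral_const_mul,
    ← integral_add (h1.integral_prod_right.const_mul _) (h2.integral_prod_right.const_mul _)]
  refine integral_mono (hside.const_mul L)
    ((h1.integral_prod_right.const_mul _).add (h2.integral_prod_right.const_mul _)) fun y => ?_
  exact sq_norm_le_integral hL (fun x => hasDerivAt_partialX hf x y)
    ((contDiff_partialX hf).continuous.comp (continuous_id.prodMk continuous_const)) hs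

theorem integral_comp_swap_squareMeasure (g : ℝ × ℝ → ℝ) :
    ∫ p, g p.swap ∂squareMeasure L = ∫ p, g p ∂squareMeasure L := by
  rw [squareMeasure_eq_prod, integral_prod_swap]

theorem integral_horizontal_side_le (hL : 0 < L) {f : ℝ × ℝ → 𝕜} (hf : ContDiff ℝ ∞ f) {s : ℝ}
    (hs : s ∈ Icc 0 L) :
    L * ∫ x in Ioo 0 L, ‖f (x, s)‖ ^ 2 ≤ 2 * (∫ p, ‖f p‖ ^ 2 ∂squareMeasure L) +
      2 * L ^ 2 * ∫ p, ‖partialY f p‖ ^ 2 ∂squareMeasure L := by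
  have h := integral_vertical_side_le hL (contDiff_comp_swap hf) hs
  rw [partialX_comp_swap] at h
  simpa only [Function.comp, Prod.swap_prod_mk,
    integral_comp_swap_squareMeasure (fun p => ‖f p‖ ^ 2),
    integral_comp_swap_squareMeasure (fun p => ‖partialY f p‖ ^ 2)] using h

/-- The trace inequality for functions that are smooth up to the boundary. -/
theorem integral_boundary_le (hL : 0 < L) {f : ℝ × ℝ → 𝕜} (hf : ContDiff ℝ ∞ f) :
    L * ∫ p, ‖f p‖ ^ 2 ∂squareBoundaryMeasure L ≤ 8 * (∫ p, ‖f p‖ ^ 2 ∂squareMeasure L) +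
      4 * L ^ 2 * (∫ p, ‖partialX f p‖ ^ 2 ∂squareMeasure L) +
      4 * L ^ 2 * ∫ p, ‖partialY f p‖ ^ 2 ∂squareMeasure L := by
  have hc : Continuous fun p => ‖f p‖ ^ 2 := hf.continuous.norm.pow 2
  have hint : ∀ {a : ℝ → ℝ × ℝ}, Continuous a →
      Integrable (fun p => ‖f p‖ ^ 2) ((volume.restrict (Ioo 0 L)).map a) := by
    intro a ha
    rw [integrable_map_measure hc.aestronglyMeasurable ha.aemeasurable]
    exact (hc.comp ha).integrableOn_Icc.mono_set Ioo_subset_Icc_self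
  have hmap : ∀ {a : ℝ → ℝ × ℝ}, Continuous a →
      ∫ p, ‖f p‖ ^ 2 ∂(volume.restrict (Ioo 0 L)).map a = ∫ t in Ioo 0 L, ‖f (a t)‖ ^ 2 :=
    fun ha => integral_map ha.aemeasurable hc.aestronglyMeasurable
  have c1 := (isSide_left L).1
  have c2 := (isSide_right L).1
  have c3 := (isSide_bottom L).1
  have c4 := (isSide_top L).1
  rw [squareBoundaryMeasure, integral_add_measure ((hint c1).add_measure (hint c2))
    ((hint c3).add_measure (hint c4)), integral_add_measure (hint c1) (hint c2),
    integral_add_measure (hint c3) (hint c4), hmap c1, hmap c2, hmap c3, hmap c4]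
  have h0 : (0 : ℝ) ∈ Icc 0 L := ⟨le_rfl, hL.le⟩
  have h1 : L ∈ Icc 0 L := ⟨hL.le, le_rfl⟩
  linarith [integral_vertical_side_le hL hf h0, integral_vertical_side_le hL hf h1,
    integral_horizontal_side_le hL hf h0, integral_horizontal_side_le hL hf h1]

end TraceInequality

/-! ### Partial sums of Hartley series and their traces -/

section PartialSums

variable {𝕜 : Type*} [RCLike 𝕜] {L : ℝ}

/-- The symmetric box `{-n, …, n}²` of frequencies. -/
noncomputable def freqBox (n : ℕ) : Finset (ℤ × ℤ) := Finset.Icc (-n : ℤ) n ×ˢ Finset.Icc (-n : ℤ) n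

theorem tendsto_freqBox : Tendsto freqBox atTop atTop := by
  refine tendsto_atTop_finset_of_monotone ?_ ?_
  · intro m n h
    have : (m : ℤ) ≤ n := by exact_mod_cast h
    exact Finset.product_subset_product (Finset.Icc_subset_Icc (by omega) this)
      (Finset.Icc_subset_Icc (by omega) this)
  · intro ξ
    refine ⟨ξ.1.natAbs + ξ.2.natAbs, ?_⟩
    simp only [freqBox, Finset.mem_product, Finset.mem_Icc]
    omega

variable (L) in
/-- The partial sum over `{-n, …, n}²` of the Hartley series with coefficients `c`. -/
noncomputable def hartleySum (c : ℤ × ℤ → 𝕜) (n : ℕ) (p : ℝ × ℝ) : 𝕜 :=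
  ∑ ξ ∈ freqBox n, hartley₂ L ξ p • c ξ

theorem contDiff_hartleySum (c : ℤ × ℤ → 𝕜) (n : ℕ) : ContDiff ℝ ∞ (hartleySum L c n) :=
  ContDiff.sum fun ξ _ => (contDiff_hartley₂ L ξ).smul contDiff_const

theorem partialX_hartleySum (c : ℤ × ℤ → 𝕜) (n : ℕ) :
    partialX (hartleySum L c n) = hartleySum L (coeffX L c) n := by
  funext p
  have h : HasDerivAt (fun t => hartleySum L c n (t, p.2))
      (∑ ξ ∈ freqBox n, (freq L ξ.1 * hartley L (-ξ.1) p.1 * hartley L ξ.2 p.2) • c ξ) p.1 :=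
    HasDerivAt.fun_sum fun ξ _ =>
      ((hasDerivAt_hartley L ξ.1 p.1).mul_const (hartley L ξ.2 p.2)).smul_const (c ξ)
  rw [partialX, h.deriv, hartleySum]
  refine Finset.sum_equiv reflX (fun ξ => ?_) fun ξ _ => ?_
  · simp only [freqBox, reflX, Finset.mem_product, Finset.mem_Icc, Equiv.prodCongr_apply,
      Prod.map, Equiv.neg_apply, Equiv.refl_apply]
    omega
  · simp only [reflX, Equiv.prodCongr_apply, Prod.map, Equiv.neg_apply, Equiv.refl_apply, hartley₂,
      coeffX, freq_neg, neg_neg, neg_smul, smul_smul]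
    congr 1
    ring

theorem partialY_hartleySum (c : ℤ × ℤ → 𝕜) (n : ℕ) :
    partialY (hartleySum L c n) = hartleySum L (coeffY L c) n := by
  funext p
  have h : HasDerivAt (fun t => hartleySum L c n (p.1, t))
      (∑ ξ ∈ freqBox n, (hartley L ξ.1 p.1 * (freq L ξ.2 * hartley L (-ξ.2) p.2)) • c ξ) p.2 :=
    HasDerivAt.fun_sum fun ξ _ =>
      ((hasDerivAt_hartley L ξ.2 p.2).const_mul (hartley L ξ.1 p.1)).smul_const (c ξ)
  rw [partialY, h.deriv, hartleySum]
  refine Finset.sum_equiv reflY (fun ξ => ?_) fun ξ _ => ?_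
  · simp only [freqBox, reflY, Finset.mem_product, Finset.mem_Icc, Equiv.prodCongr_apply,
      Prod.map, Equiv.neg_apply, Equiv.refl_apply]
    omega
  · simp only [reflY, Equiv.prodCongr_apply, Prod.map, Equiv.neg_apply, Equiv.refl_apply, hartley₂,
      coeffY, freq_neg, neg_neg, neg_smul, smul_smul]
    congr 1
    ring

/-- The pointwise partial sums represent the partial sums of the expansion in `L²(Ω)`. -/
theorem toLp_hartleySum (c : ℤ × ℤ → 𝕜) (n : ℕ) :
    (memLp_squareMeasure_of_continuous (contDiff_hartleySum (L := L) c n).continuous).toLp _ =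
      ∑ ξ ∈ freqBox n, c ξ • hartleyVec 𝕜 L ξ := by
  refine Lp.ext ?_
  have h : ∀ᵐ p ∂squareMeasure L, ∀ ξ : ℤ × ℤ,
      (c ξ • hartleyVec 𝕜 L ξ : SquareL2 𝕜 L) p = hartley₂ L ξ p • c ξ := by
    refine ae_all_iff.2 fun ξ => ?_
    filter_upwards [Lp.coeFn_smul (c ξ) (hartleyVec 𝕜 L ξ), coeFn_hartleyVec (𝕜 := 𝕜) (L := L) ξ]
      with p h1 h2
    rw [h1, Pi.smul_apply, h2, smul_eq_mul, RCLike.real_smul_eq_coe_mul, mul_comm]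
  filter_upwards [MemLp.coeFn_toLp (memLp_squareMeasure_of_continuous
    (contDiff_hartleySum (L := L) c n).continuous),
    Lp.coeFn_finsetSum (freqBox n) (fun ξ => c ξ • hartleyVec 𝕜 L ξ), h] with p h1 h2 h3
  rw [h1, h2, Finset.sum_apply, hartleySum]
  exact Finset.sum_congr rfl fun ξ _ => (h3 ξ).symm

theorem tendsto_toLp_hartleySum (hL : 0 < L) (u : SquareL2 𝕜 L) :
    Tendsto (fun n => (memLp_squareMeasure_of_continuous
      (contDiff_hartleySum (L := L) (hartleyCoeff L u) n).continuous).toLp _) atTop (𝓝 u) := by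
  simp only [toLp_hartleySum]
  exact (hasSum_hartleyCoeff_smul hL u).comp tendsto_freqBox

theorem tendsto_eLpNorm_hartleySum (hL : 0 < L) (u : SquareL2 𝕜 L) :
    Tendsto (fun n => eLpNorm (hartleySum L (hartleyCoeff L u) n - ⇑u) 2 (squareMeasure L)) atTop
      (𝓝 0) := by
  have h := (Lp.tendsto_Lp_iff_tendsto_eLpNorm' _ _).1 (tendsto_toLp_hartleySum hL u)
  refine h.congr fun n => eLpNorm_congr_ae ?_
  filter_upwards [MemLp.coeFn_toLp (memLp_squareMeasure_of_continuous
    (contDiff_hartleySum (L := L) (hartleyCoeff L u) n).continuous)] with p hp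
  rw [Pi.sub_apply, Pi.sub_apply, hp]

theorem memLp_boundary_of_continuous {f : ℝ × ℝ → 𝕜} (hf : Continuous f) :
    MemLp f 2 (squareBoundaryMeasure L) := by
  have hmap : ∀ {a : ℝ → ℝ × ℝ}, Continuous a →
      Integrable (fun p => ‖f p‖ ^ 2) ((volume.restrict (Ioo 0 L)).map a) := fun ha =>
    (integrable_map_measure (hf.norm.pow 2).aestronglyMeasurable ha.aemeasurable).2
      (((hf.norm.pow 2).comp ha).integrableOn_Icc.mono_set Ioo_subset_Icc_self)
  refine (memLp_two_iff_integrable_sq_norm hf.aestronglyMeasurable).2 ?_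
  exact ((hmap (isSide_left L).1).add_measure (hmap (isSide_right L).1)).add_measure
    ((hmap (isSide_bottom L).1).add_measure (hmap (isSide_top L).1))

theorem integral_sq_norm_eq {X : Type*} [MeasurableSpace X] {μ : Measure X} {f : X → 𝕜}
    (hf : MemLp f 2 μ) : ∫ x, ‖f x‖ ^ 2 ∂μ = ‖hf.toLp f‖ ^ 2 := by
  have h := L2.inner_def (𝕜 := 𝕜) (hf.toLp f) (hf.toLp f)
  rw [inner_self_eq_norm_sq_to_K] at h
  have e : ∫ x, inner 𝕜 (hf.toLp f x) (hf.toLp f x) ∂μ = ((∫ x, ‖f x‖ ^ 2 ∂μ : ℝ) : 𝕜) := by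
    rw [← integral_ofReal]
    refine integral_congr_ae ?_
    filter_upwards [hf.coeFn_toLp] with x hx
    rw [hx, inner_self_eq_norm_sq_to_K, RCLike.ofReal_pow]
  rw [e] at h
  exact_mod_cast h.symm

/-- The trace inequality in terms of norms. -/
theorem norm_toLp_boundary_le (hL : 0 < L) : ∃ C : ℝ, 0 ≤ C ∧ ∀ {f : ℝ × ℝ → 𝕜}
    (hf : ContDiff ℝ ∞ f),
    ‖(memLp_boundary_of_continuous (L := L) hf.continuous).toLp f‖ ≤
      C * (‖(memLp_squareMeasure_of_continuous (L := L) hf.continuous).toLp f‖ +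
        ‖(memLp_squareMeasure_of_continuous (L := L) (contDiff_partialX hf).continuous).toLp _‖ +
        ‖(memLp_squareMeasure_of_continuous (L := L) (contDiff_partialY hf).continuous).toLp _‖) := by
  refine ⟨√(8 / L + 4 * L), by positivity, fun {f} hf => ?_⟩
  have h := integral_boundary_le hL hf
  rw [integral_sq_norm_eq (memLp_boundary_of_continuous hf.continuous),
    integral_sq_norm_eq (memLp_squareMeasure_of_continuous hf.continuous),
    integral_sq_norm_eq (memLp_squareMeasure_of_continuous (contDiff_partialX hf).continuous),
    integral_sq_norm_eq (memLp_squareMeasure_of_continuous (contDiff_partialY hf).continuous)] at h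
  set z := ‖(memLp_boundary_of_continuous (L := L) hf.continuous).toLp f‖
  set a := ‖(memLp_squareMeasure_of_continuous (L := L) hf.continuous).toLp f‖
  set b := ‖(memLp_squareMeasure_of_continuous (L := L) (contDiff_partialX hf).continuous).toLp _‖
  set c := ‖(memLp_squareMeasure_of_continuous (L := L) (contDiff_partialY hf).continuous).toLp _‖
  have ha : 0 ≤ a := norm_nonneg _
  have hb : 0 ≤ b := norm_nonneg _
  have hc : 0 ≤ c := norm_nonneg _
  refine abs_le_of_sq_le_sq' ?_ (by positivity) |>.2
  rw [mul_pow, Real.sq_sqrt (by positivity)]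
  have h1 : z ^ 2 ≤ 8 / L * a ^ 2 + 4 * L * (b ^ 2 + c ^ 2) := by
    refine le_of_mul_le_mul_left (h.trans_eq ?_) hL
    field_simp
    ring
  have h2 : a ^ 2 ≤ (a + b + c) ^ 2 := by gcongr; linarith
  have h3 : b ^ 2 + c ^ 2 ≤ (a + b + c) ^ 2 := by
    nlinarith [mul_nonneg hb hc, mul_nonneg ha hb, mul_nonneg ha hc]
  calc z ^ 2 ≤ 8 / L * a ^ 2 + 4 * L * (b ^ 2 + c ^ 2) := h1
    _ ≤ 8 / L * (a + b + c) ^ 2 + 4 * L * (a + b + c) ^ 2 := by gcongr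
    _ = _ := by ring

theorem partialX_sub {f g : ℝ × ℝ → 𝕜} (hf : ContDiff ℝ ∞ f) (hg : ContDiff ℝ ∞ g) :
    partialX (f - g) = partialX f - partialX g := by
  funext p
  exact ((hasDerivAt_partialX hf p.1 p.2).sub (hasDerivAt_partialX hg p.1 p.2)).deriv

theorem partialY_sub {f g : ℝ × ℝ → 𝕜} (hf : ContDiff ℝ ∞ f) (hg : ContDiff ℝ ∞ g) :
    partialY (f - g) = partialY f - partialY g := by
  funext p
  have h : ∀ {k : ℝ × ℝ → 𝕜}, ContDiff ℝ ∞ k → DifferentiableAt ℝ (fun t => k (p.1, t)) p.2 :=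
    fun hk => ((hk.comp (contDiff_const.prodMk contDiff_id)).differentiable (by simp)) p.2
  exact deriv_sub (h hf) (h hg)

/-- If smooth functions converge in `H¹(Ω)`, their restrictions to the boundary converge in
`L²(∂Ω)`. -/
theorem exists_tendsto_boundary (hL : 0 < L) {φ : ℕ → ℝ × ℝ → 𝕜} (hφ : ∀ n, ContDiff ℝ ∞ (φ n))
    {v vx vy : SquareL2 𝕜 L}
    (h : Tendsto (fun n => eLpNorm (φ n - ⇑v) 2 (squareMeasure L)) atTop (𝓝 0))
    (hx : Tendsto (fun n => eLpNorm (partialX (φ n) - ⇑vx) 2 (squareMeasure L)) atTop (𝓝 0))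
    (hy : Tendsto (fun n => eLpNorm (partialY (φ n) - ⇑vy) 2 (squareMeasure L)) atTop (𝓝 0)) :
    ∃ g : SquareBoundaryL2 𝕜 L,
      Tendsto (fun n => eLpNorm (φ n - ⇑g) 2 (squareBoundaryMeasure L)) atTop (𝓝 0) := by
  have cauchy : ∀ {ψ : ℕ → ℝ × ℝ → 𝕜} (hψ : ∀ n, Continuous (ψ n)) {w : SquareL2 𝕜 L},
      Tendsto (fun n => eLpNorm (ψ n - ⇑w) 2 (squareMeasure L)) atTop (𝓝 0) →
      CauchySeq fun n => (memLp_squareMeasure_of_continuous (L := L) (hψ n)).toLp (ψ n) := by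
    intro ψ hψ w hw
    refine Tendsto.cauchySeq (x := w) ?_
    have := (Lp.tendsto_Lp_iff_tendsto_eLpNorm'' ψ
      (fun n => memLp_squareMeasure_of_continuous (L := L) (hψ n)) w (Lp.memLp w)).2 hw
    rwa [Lp.toLp_coeFn] at this
  have hφx := fun n => contDiff_partialX (hφ n)
  have hφy := fun n => contDiff_partialY (hφ n)
  have k1 := cauchy (fun n => (hφ n).continuous) h
  have k2 := cauchy (fun n => (hφx n).continuous) hx
  have k3 := cauchy (fun n => (hφy n).continuous) hy
  obtain ⟨C, hC0, hC⟩ := norm_toLp_boundary_le (𝕜 := 𝕜) hL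
  have hG : CauchySeq fun n =>
      (memLp_boundary_of_continuous (L := L) (hφ n).continuous).toLp (φ n) := by
    rw [Metric.cauchySeq_iff] at k1 k2 k3 ⊢
    intro ε hε
    have hδ : 0 < ε / (3 * (C + 1)) := by positivity
    obtain ⟨N1, h1⟩ := k1 _ hδ
    obtain ⟨N2, h2⟩ := k2 _ hδ
    obtain ⟨N3, h3⟩ := k3 _ hδ
    refine ⟨max N1 (max N2 N3), fun m hm n hn => ?_⟩
    simp only [ge_iff_le, max_le_iff] at hm hn
    have e1 := h1 m hm.1 n hn.1
    have e2 := h2 m hm.2.1 n hn.2.1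
    have e3 := h3 m hm.2.2 n hn.2.2
    rw [dist_eq_norm, ← MemLp.toLp_sub] at e1 e2 e3 ⊢
    have hsub : ContDiff ℝ ∞ (φ m - φ n) := (hφ m).sub (hφ n)
    have hle := hC hsub
    simp only [partialX_sub (hφ m) (hφ n), partialY_sub (hφ m) (hφ n)] at hle
    refine hle.trans_lt ?_
    calc _ ≤ C * (ε / (3 * (C + 1)) + ε / (3 * (C + 1)) + ε / (3 * (C + 1))) := by
          gcongr
      _ = C / (C + 1) * ε := by field_simp; ring
      _ < 1 * ε := by
          gcongr
          rw [div_lt_one (by positivity)]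
          linarith
      _ = ε := one_mul ε
  obtain ⟨g, hg⟩ := cauchySeq_tendsto_of_complete hG
  refine ⟨g, (Lp.tendsto_Lp_iff_tendsto_eLpNorm'' φ
    (fun n => memLp_boundary_of_continuous (L := L) (hφ n).continuous) g (Lp.memLp g)).1 ?_⟩
  rwa [Lp.toLp_coeFn]

/-- A function whose formal first derivatives are square integrable lies in `H¹(Ω)` and has a
trace that is periodic in both directions, namely the limit of the traces of the partial sums of
its Hartley series. -/
theorem tracePeriodic_of_hartleyCoeff (hL : 0 < L) {v vx vy : SquareL2 𝕜 L}
    (hx : hartleyCoeff L vx = coeffX L (hartleyCoeff L v))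
    (hy : hartleyCoeff L vy = coeffY L (hartleyCoeff L v)) :
    TracePeriodicX v ∧ TracePeriodicY v := by
  have wx : IsWeakDeriv (1, 0) v vx := isWeakDeriv_of_hartleyCoeff hL hx
  have wy : IsWeakDeriv (0, 1) v vy := isWeakDeriv_of_hartleyCoeff hL hy
  have hv : v ∈ sobolevSubmodule 𝕜 L 1 := by
    rintro ⟨a, b⟩ hab
    have hcases : (a = 0 ∧ b = 0) ∨ (a = 1 ∧ b = 0) ∨ (a = 0 ∧ b = 1) := by
      simp only at hab; omega
    obtain ⟨rfl, rfl⟩ | ⟨rfl, rfl⟩ | ⟨rfl, rfl⟩ := hcases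
    exacts [⟨v, isWeakDeriv_zero_index v⟩, ⟨vx, wx⟩, ⟨vy, wy⟩]
  have hφ := contDiff_hartleySum (L := L) (hartleyCoeff L v)
  have t1 := tendsto_eLpNorm_hartleySum hL v
  have t2 := tendsto_eLpNorm_hartleySum hL vx
  have t3 := tendsto_eLpNorm_hartleySum hL vy
  simp only [hx, ← partialX_hartleySum] at t2
  simp only [hy, ← partialY_hartleySum] at t3
  obtain ⟨g, hg⟩ := exists_tendsto_boundary hL hφ t1 t2 t3
  have htr : IsTrace v g := by
    refine ⟨hv, _, hφ, t1, ?_, ?_, hg⟩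
    · rwa [wx.weakDeriv_eq]
    · rwa [wy.weakDeriv_eq]
  refine ⟨⟨g, htr, ?_⟩, ⟨g, htr, ?_⟩⟩
  · refine ae_eq_of_tendsto_of_jump_eq_zero (isSide_left L) (isSide_right L)
      (fun n => (hφ n).continuous) hg fun n t => ?_
    simp only [hartleySum, hartley₂, hartley_period hL]
  · refine ae_eq_of_tendsto_of_jump_eq_zero (isSide_bottom L) (isSide_top L)
      (fun n => (hφ n).continuous) hg fun n t => ?_
    simp only [hartleySum, hartley₂, hartley_period hL]

end PartialSums

/-! ### Periodic Sobolev spaces in terms of Hartley coefficients -/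

section Weights

variable {L : ℝ}

/-- The squared modulus `λ_i^{2α₁} λ_j^{2α₂}` of the Fourier symbol of `D^α` at `ξ = (i, j)`. -/
noncomputable def derivWeight (L : ℝ) (α : ℕ × ℕ) (ξ : ℤ × ℤ) : ℝ :=
  (freq L ξ.1 ^ 2) ^ α.1 * (freq L ξ.2 ^ 2) ^ α.2

/-- The weight `∑_{|α| ≤ m} λ_i^{2α₁} λ_j^{2α₂}` describing the norm of `H_P^m(Ω)`. -/
noncomputable def sobolevWeight (L : ℝ) (m : ℕ) (ξ : ℤ × ℤ) : ℝ :=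
  ∑ α ∈ PeriodicSobolev.multiIndices m, derivWeight L α ξ

/-- The symbol `1 + λ_i² + λ_j²` of `-Δ + 1`. -/
noncomputable def ellipticSymbol (L : ℝ) (ξ : ℤ × ℤ) : ℝ := 1 + freq L ξ.1 ^ 2 + freq L ξ.2 ^ 2

theorem one_le_ellipticSymbol (L : ℝ) (ξ : ℤ × ℤ) : 1 ≤ ellipticSymbol L ξ := by
  unfold ellipticSymbol; nlinarith [sq_nonneg (freq L ξ.1), sq_nonneg (freq L ξ.2)]

theorem ellipticSymbol_pos (L : ℝ) (ξ : ℤ × ℤ) : 0 < ellipticSymbol L ξ :=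
  zero_lt_one.trans_le (one_le_ellipticSymbol L ξ)

theorem derivWeight_nonneg (L : ℝ) (α : ℕ × ℕ) (ξ : ℤ × ℤ) : 0 ≤ derivWeight L α ξ := by
  unfold derivWeight; positivity

theorem mem_multiIndices {m : ℕ} {α : ℕ × ℕ} :
    α ∈ PeriodicSobolev.multiIndices m ↔ α.1 + α.2 ≤ m := by
  simp only [PeriodicSobolev.multiIndices, Finset.mem_filter, Finset.mem_product,
    Finset.mem_range]
  omega

theorem derivWeight_le_sobolevWeight {m : ℕ} {α : ℕ × ℕ} (hα : α.1 + α.2 ≤ m) (ξ : ℤ × ℤ) :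
    derivWeight L α ξ ≤ sobolevWeight L m ξ :=
  Finset.single_le_sum (f := fun α => derivWeight L α ξ) (fun β _ => derivWeight_nonneg L β ξ)
    (mem_multiIndices.2 hα)

theorem derivWeight_le_pure (α : ℕ × ℕ) (ξ : ℤ × ℤ) :
    derivWeight L α ξ ≤ derivWeight L (α.1 + α.2, 0) ξ + derivWeight L (0, α.1 + α.2) ξ := by
  have hs := sq_nonneg (freq L ξ.1)
  have ht := sq_nonneg (freq L ξ.2)
  simp only [derivWeight, pow_zero, mul_one, one_mul]
  rcases le_total (freq L ξ.1 ^ 2) (freq L ξ.2 ^ 2) with h | h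
  · calc _ ≤ (freq L ξ.2 ^ 2) ^ α.1 * (freq L ξ.2 ^ 2) ^ α.2 := by gcongr
      _ = (freq L ξ.2 ^ 2) ^ (α.1 + α.2) := (pow_add _ _ _).symm
      _ ≤ _ := le_add_of_nonneg_left (by positivity)
  · calc _ ≤ (freq L ξ.1 ^ 2) ^ α.1 * (freq L ξ.1 ^ 2) ^ α.2 := by gcongr
      _ = (freq L ξ.1 ^ 2) ^ (α.1 + α.2) := (pow_add _ _ _).symm
      _ ≤ _ := le_add_of_nonneg_right (by positivity)

theorem sobolevWeight_le (m : ℕ) (ξ : ℤ × ℤ) : sobolevWeight L m ξ ≤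
    (PeriodicSobolev.multiIndices m).card * ellipticSymbol L ξ ^ m := by
  rw [← nsmul_eq_mul]
  refine Finset.sum_le_card_nsmul _ _ _ fun α hα => ?_
  have hs : freq L ξ.1 ^ 2 ≤ ellipticSymbol L ξ := by
    unfold ellipticSymbol; nlinarith [sq_nonneg (freq L ξ.2)]
  have ht : freq L ξ.2 ^ 2 ≤ ellipticSymbol L ξ := by
    unfold ellipticSymbol; nlinarith [sq_nonneg (freq L ξ.1)]
  have h0 := (ellipticSymbol_pos L ξ).le
  calc derivWeight L α ξ ≤ ellipticSymbol L ξ ^ α.1 * ellipticSymbol L ξ ^ α.2 := by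
        unfold derivWeight; gcongr
    _ = ellipticSymbol L ξ ^ (α.1 + α.2) := (pow_add _ _ _).symm
    _ ≤ _ := pow_le_pow_right₀ (one_le_ellipticSymbol L ξ) (mem_multiIndices.1 hα)

/-- Conversely, the `m`-th power of the symbol is controlled by the weight. -/
theorem le_sobolevWeight (m : ℕ) (ξ : ℤ × ℤ) :
    ellipticSymbol L ξ ^ m ≤ 3 ^ m * sobolevWeight L m ξ := by
  have hs := sq_nonneg (freq L ξ.1)
  have ht := sq_nonneg (freq L ξ.2)
  have h0 := (ellipticSymbol_pos L ξ).le
  have key : ∀ z : ℝ, ellipticSymbol L ξ ≤ 3 * z → z ^ m ≤ sobolevWeight L m ξ →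
      ellipticSymbol L ξ ^ m ≤ 3 ^ m * sobolevWeight L m ξ := fun z h1 h2 =>
    calc ellipticSymbol L ξ ^ m ≤ (3 * z) ^ m := by gcongr
      _ = 3 ^ m * z ^ m := mul_pow _ _ _
      _ ≤ _ := by gcongr
  have d0 := derivWeight_le_sobolevWeight (L := L) (m := m) (α := (0, 0)) (by simp) ξ
  have d1 := derivWeight_le_sobolevWeight (L := L) (m := m) (α := (m, 0)) (by simp) ξ
  have d2 := derivWeight_le_sobolevWeight (L := L) (m := m) (α := (0, m)) (by simp) ξ
  simp only [derivWeight, pow_zero, mul_one, one_mul] at d0 d1 d2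
  -- the largest of the three summands of the symbol dominates
  rcases le_total (freq L ξ.1 ^ 2) (freq L ξ.2 ^ 2) with h | h
  · rcases le_total 1 (freq L ξ.2 ^ 2) with h' | h'
    · exact key _ (by unfold ellipticSymbol; linarith) d2
    · exact key 1 (by unfold ellipticSymbol; linarith) (by simpa using d0)
  · rcases le_total 1 (freq L ξ.1 ^ 2) with h' | h'
    · exact key _ (by unfold ellipticSymbol; linarith) d1
    · exact key 1 (by unfold ellipticSymbol; linarith) (by simpa using d0)

/-- Dividing by the symbol of `-Δ + 1` gains two derivatives, uniformly in `L`. -/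
theorem sobolevWeight_add_two_le (m : ℕ) (ξ : ℤ × ℤ) :
    sobolevWeight L (m + 2) ξ ≤ ((PeriodicSobolev.multiIndices (m + 2)).card * 3 ^ m) *
      (ellipticSymbol L ξ ^ 2 * sobolevWeight L m ξ) := by
  refine (sobolevWeight_le (m + 2) ξ).trans ?_
  have h := le_sobolevWeight (L := L) m ξ
  have h0 := (ellipticSymbol_pos L ξ).le
  rw [pow_add]
  calc _ ≤ ((PeriodicSobolev.multiIndices (m + 2)).card : ℝ) *
        ((3 ^ m * sobolevWeight L m ξ) * ellipticSymbol L ξ ^ 2) := by gcongr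
    _ = _ := by ring

end Weights

section Characterization

variable {𝕜 : Type*} [RCLike 𝕜] {L : ℝ}

/-- `D^α` acts on Hartley coefficients by the modulus of its symbol, up to signs and reflections
of the frequencies. -/
theorem exists_equiv_norm_coeffDeriv (L : ℝ) (α : ℕ × ℕ) : ∃ e : ℤ × ℤ ≃ ℤ × ℤ,
    ∀ (c : ℤ × ℤ → 𝕜) (ξ : ℤ × ℤ), derivWeight L α (e ξ) * ‖c (e ξ)‖ ^ 2 =
      ‖coeffDeriv L α c ξ‖ ^ 2 := by
  have hy : ∀ n : ℕ, ∃ e : ℤ × ℤ ≃ ℤ × ℤ, ∀ (c : ℤ × ℤ → 𝕜) (ξ : ℤ × ℤ),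
      derivWeight L (0, n) (e ξ) * ‖c (e ξ)‖ ^ 2 = ‖coeffDeriv L (0, n) c ξ‖ ^ 2 := by
    intro n
    induction n with
    | zero => exact ⟨Equiv.refl _, fun c ξ => by simp [derivWeight, coeffDeriv]⟩
    | succ n ih =>
      obtain ⟨e, he⟩ := ih
      refine ⟨e.trans reflY, fun c ξ => ?_⟩
      have h : coeffDeriv L (0, n + 1) c = coeffDeriv L (0, n) (coeffY L c) := rfl
      rw [h, ← he]
      simp only [reflY, coeffY, derivWeight, Equiv.trans_apply, Equiv.prodCongr_apply, Prod.map,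
        Equiv.neg_apply, Equiv.refl_apply, freq_neg, norm_neg, norm_smul, Real.norm_eq_abs,
        mul_pow, sq_abs, neg_sq, pow_succ _ n, pow_zero, one_mul]
      ring
  obtain ⟨m, n⟩ := α
  induction m with
  | zero => exact hy n
  | succ m ih =>
    obtain ⟨e, he⟩ := ih
    refine ⟨e.trans reflX, fun c ξ => ?_⟩
    have h : coeffDeriv L (m + 1, n) c = coeffDeriv L (m, n) (coeffX L c) := by
      rw [coeffDeriv, coeffDeriv,
        ← (commute_coeffX_coeffY (E := 𝕜) (L := L)).iterate_right n c,
        ← Function.iterate_succ_apply]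
    rw [h, ← he]
    simp only [reflX, coeffX, derivWeight, Equiv.trans_apply, Equiv.prodCongr_apply, Prod.map,
      Equiv.neg_apply, Equiv.refl_apply, freq_neg, norm_neg, norm_smul, Real.norm_eq_abs,
      mul_pow, sq_abs, neg_sq, pow_succ _ m]
    ring

theorem hasSum_coeffDeriv_iff (α : ℕ × ℕ) (c : ℤ × ℤ → 𝕜) (s : ℝ) :
    HasSum (fun ξ => ‖coeffDeriv L α c ξ‖ ^ 2) s ↔
      HasSum (fun ξ => derivWeight L α ξ * ‖c ξ‖ ^ 2) s := by
  obtain ⟨e, he⟩ := exists_equiv_norm_coeffDeriv (𝕜 := 𝕜) L α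
  rw [← e.hasSum_iff (f := fun ξ => derivWeight L α ξ * ‖c ξ‖ ^ 2)]
  exact iff_of_eq (congrArg (HasSum · s) (funext fun ξ => (he c ξ).symm))

theorem summable_coeffDeriv_iff (α : ℕ × ℕ) (c : ℤ × ℤ → 𝕜) :
    Summable (fun ξ => ‖coeffDeriv L α c ξ‖ ^ 2) ↔
      Summable (fun ξ => derivWeight L α ξ * ‖c ξ‖ ^ 2) :=
  exists_congr fun s => hasSum_coeffDeriv_iff α c s

theorem IsWeakDeriv.succ_x {k : ℕ} {u v w : SquareL2 𝕜 L} (h : IsWeakDeriv (k, 0) u v)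
    (h' : IsWeakDeriv (1, 0) v w) : IsWeakDeriv (k + 1, 0) u w := by
  intro φ hφ
  have h1 : ∫ p, iteratedPartial (k + 1, 0) φ p • u p ∂squareMeasure L =
      (-1 : ℝ) ^ (k + 0) • ∫ p, partialX φ p • v p ∂squareMeasure L := h _ hφ.partialX
  have h2 : ∫ p, partialX φ p • v p ∂squareMeasure L =
      (-1 : ℝ) ^ (1 + 0) • ∫ p, φ p • w p ∂squareMeasure L := h' φ hφ
  rw [h1, h2, smul_smul, ← pow_add]
  rfl

theorem IsWeakDeriv.succ_y {k : ℕ} {u v w : SquareL2 𝕜 L} (h : IsWeakDeriv (0, k) u v)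
    (h' : IsWeakDeriv (0, 1) v w) : IsWeakDeriv (0, k + 1) u w := by
  intro φ hφ
  have h1 : ∫ p, iteratedPartial (0, k + 1) φ p • u p ∂squareMeasure L =
      (-1 : ℝ) ^ (0 + k) • ∫ p, partialY φ p • v p ∂squareMeasure L := h _ hφ.partialY
  have h2 : ∫ p, partialY φ p • v p ∂squareMeasure L =
      (-1 : ℝ) ^ (0 + 1) • ∫ p, φ p • w p ∂squareMeasure L := h' φ hφ
  rw [h1, h2, smul_smul, ← pow_add]
  rfl

/-- The pure derivatives `∂_x^k` of a function in `H_P^m(Ω)` may be computed on its Hartley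
series, by one integration by parts for each derivative. -/
theorem hartleyCoeff_weakDeriv_x (hL : 0 < L) {m : ℕ} {u : SquareL2 𝕜 L}
    (hu : u ∈ periodicSobolevSubmodule 𝕜 L m) {k : ℕ} (hk : k ≤ m) :
    hartleyCoeff L (weakDeriv (k, 0) u) = coeffDeriv L (k, 0) (hartleyCoeff L u) := by
  induction k with
  | zero => rw [(isWeakDeriv_zero_index u).weakDeriv_eq]; rfl
  | succ k ih =>
    have hper := (hu.2 k hk).1
    have hv : weakDeriv (k, 0) u ∈ sobolevSubmodule 𝕜 L 1 := hper.choose_spec.1.1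
    have hw := (isWeakDeriv_weakDeriv (hu.1 (k, 0) (by simpa using (k.le_succ.trans hk)))).succ_x
      (isWeakDeriv_weakDeriv (hv (1, 0) le_rfl))
    rw [hw.weakDeriv_eq, hper.hartleyCoeff_weakDeriv hL, ih (k.le_succ.trans hk),
      coeffX_coeffDeriv]

theorem hartleyCoeff_weakDeriv_y (hL : 0 < L) {m : ℕ} {u : SquareL2 𝕜 L}
    (hu : u ∈ periodicSobolevSubmodule 𝕜 L m) {k : ℕ} (hk : k ≤ m) :
    hartleyCoeff L (weakDeriv (0, k) u) = coeffDeriv L (0, k) (hartleyCoeff L u) := by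
  induction k with
  | zero => rw [(isWeakDeriv_zero_index u).weakDeriv_eq]; rfl
  | succ k ih =>
    have hper := (hu.2 k hk).2
    have hv : weakDeriv (0, k) u ∈ sobolevSubmodule 𝕜 L 1 := hper.choose_spec.1.1
    have hw := (isWeakDeriv_weakDeriv (hu.1 (0, k) (by simpa using (k.le_succ.trans hk)))).succ_y
      (isWeakDeriv_weakDeriv (hv (0, 1) le_rfl))
    rw [hw.weakDeriv_eq, hper.hartleyCoeff_weakDeriv hL, ih (k.le_succ.trans hk),
      coeffY_coeffDeriv]

/-- The mixed derivatives are controlled by the pure ones, for which periodicity of the traces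
permits integration by parts. -/
theorem summable_derivWeight (hL : 0 < L) {m : ℕ} {u : SquareL2 𝕜 L}
    (hu : u ∈ periodicSobolevSubmodule 𝕜 L m) {α : ℕ × ℕ} (hα : α.1 + α.2 ≤ m) :
    Summable fun ξ => derivWeight L α ξ * ‖hartleyCoeff L u ξ‖ ^ 2 := by
  have hx : Summable fun ξ => derivWeight L (α.1 + α.2, 0) ξ * ‖hartleyCoeff L u ξ‖ ^ 2 := by
    rw [← summable_coeffDeriv_iff, ← hartleyCoeff_weakDeriv_x hL hu hα]
    exact (hasSum_sq_hartleyCoeff hL _).summable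
  have hy : Summable fun ξ => derivWeight L (0, α.1 + α.2) ξ * ‖hartleyCoeff L u ξ‖ ^ 2 := by
    rw [← summable_coeffDeriv_iff, ← hartleyCoeff_weakDeriv_y hL hu hα]
    exact (hasSum_sq_hartleyCoeff hL _).summable
  refine Summable.of_nonneg_of_le
    (fun ξ => mul_nonneg (derivWeight_nonneg L α ξ) (by positivity)) (fun ξ => ?_) (hx.add hy)
  rw [← add_mul]
  gcongr
  exact derivWeight_le_pure α ξ

theorem hartleyCoeff_weakDeriv_of_summable (hL : 0 < L) {u : SquareL2 𝕜 L} {α : ℕ × ℕ}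
    (h : Summable fun ξ => derivWeight L α ξ * ‖hartleyCoeff L u ξ‖ ^ 2) :
    IsWeakDeriv α u (weakDeriv α u) ∧
      hartleyCoeff L (weakDeriv α u) = coeffDeriv L α (hartleyCoeff L u) := by
  obtain ⟨v, hv⟩ := exists_hartleyCoeff_eq hL ((summable_coeffDeriv_iff α _).2 h)
  have hw : IsWeakDeriv α u v := isWeakDeriv_of_hartleyCoeff hL hv
  rw [hw.weakDeriv_eq]
  exact ⟨hw, hv⟩

theorem hartleyCoeff_weakDeriv (hL : 0 < L) {m : ℕ} {u : SquareL2 𝕜 L}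
    (hu : u ∈ periodicSobolevSubmodule 𝕜 L m) {α : ℕ × ℕ} (hα : α.1 + α.2 ≤ m) :
    hartleyCoeff L (weakDeriv α u) = coeffDeriv L α (hartleyCoeff L u) :=
  (hartleyCoeff_weakDeriv_of_summable hL (summable_derivWeight hL hu hα)).2

/-- Sufficient decay of the Hartley coefficients puts a function into `H_P^m(Ω)`. -/
theorem mem_periodicSobolevSubmodule_of_summable (hL : 0 < L) {m : ℕ} {u : SquareL2 𝕜 L}
    (h : Summable fun ξ => sobolevWeight L m ξ * ‖hartleyCoeff L u ξ‖ ^ 2) :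
    u ∈ periodicSobolevSubmodule 𝕜 L m := by
  have hα : ∀ α : ℕ × ℕ, α.1 + α.2 ≤ m → IsWeakDeriv α u (weakDeriv α u) ∧
      hartleyCoeff L (weakDeriv α u) = coeffDeriv L α (hartleyCoeff L u) := by
    intro α hα
    refine hartleyCoeff_weakDeriv_of_summable hL (Summable.of_nonneg_of_le
      (fun ξ => mul_nonneg (derivWeight_nonneg L α ξ) (by positivity)) (fun ξ => ?_) h)
    gcongr
    exact derivWeight_le_sobolevWeight hα ξ
  refine ⟨fun α h => ⟨_, (hα α h).1⟩, fun k hk => ⟨?_, ?_⟩⟩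
  · refine (tracePeriodic_of_hartleyCoeff hL (vx := weakDeriv (k + 1, 0) u)
      (vy := weakDeriv (k, 1) u) ?_ ?_).1
    · rw [(hα (k, 0) (by simpa using hk.le)).2, (hα (k + 1, 0) (by simpa using hk)).2,
        coeffX_coeffDeriv]
    · rw [(hα (k, 0) (by simpa using hk.le)).2, (hα (k, 1) (by simpa using hk)).2,
        coeffY_coeffDeriv]
  · refine (tracePeriodic_of_hartleyCoeff hL (vx := weakDeriv (1, k) u)
      (vy := weakDeriv (0, k + 1) u) ?_ ?_).2
    · rw [(hα (0, k) (by simpa using hk.le)).2, (hα (1, k) (by simpa [add_comm] using hk)).2,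
        coeffX_coeffDeriv]
    · rw [(hα (0, k) (by simpa using hk.le)).2, (hα (0, k + 1) (by simpa using hk)).2,
        coeffY_coeffDeriv]

/-- The norm of `H_P^m(Ω)` is a weighted `ℓ²` norm of the Hartley coefficients. -/
theorem hasSum_sobolevWeight (hL : 0 < L) {m : ℕ} (u : PeriodicSobolev 𝕜 L m) :
    HasSum (fun ξ => sobolevWeight L m ξ * ‖hartleyCoeff L u.toL2 ξ‖ ^ 2) (‖u‖ ^ 2) := by
  rw [PeriodicSobolev.norm_eq, Real.sq_sqrt (by positivity)]
  simp only [sobolevWeight, Finset.sum_mul]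
  refine hasSum_sum fun α hα => ?_
  rw [← hasSum_coeffDeriv_iff,
    ← hartleyCoeff_weakDeriv (u := u.toL2) hL u.2 (mem_multiIndices.1 hα)]
  exact hasSum_sq_hartleyCoeff hL _

end Characterization

/-! ### The elliptic equation -/

section Elliptic

variable {𝕜 : Type*} [RCLike 𝕜] {L : ℝ} {m : ℕ}

/-- On Hartley coefficients, `-Δ + 1` is multiplication by its symbol. -/
theorem solvesElliptic_iff (hL : 0 < L) (u : PeriodicSobolev 𝕜 L (m + 2))
    (w : PeriodicSobolev 𝕜 L m) : SolvesElliptic u w ↔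
      ∀ ξ, ellipticSymbol L ξ • hartleyCoeff L u.toL2 ξ = hartleyCoeff L w.toL2 ξ := by
  have hx := hartleyCoeff_weakDeriv hL u.2 (α := (2, 0)) (by simp)
  have hy := hartleyCoeff_weakDeriv hL u.2 (α := (0, 2)) (by simp)
  have e : ∀ ξ, hartleyCoeff L (-(weakDeriv (2, 0) u.toL2 + weakDeriv (0, 2) u.toL2) + u.toL2 :
      SquareL2 𝕜 L) ξ = ellipticSymbol L ξ • hartleyCoeff L u.toL2 ξ := by
    intro ξ
    have hx' : hartleyCoeff L (weakDeriv (2, 0) u.toL2) ξ =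
        -(freq L ξ.1 ^ 2 • hartleyCoeff L u.toL2 ξ) := by
      rw [← coeffX_coeffX]; exact congrFun hx ξ
    have hy' : hartleyCoeff L (weakDeriv (0, 2) u.toL2) ξ =
        -(freq L ξ.2 ^ 2 • hartleyCoeff L u.toL2 ξ) := by
      rw [← coeffY_coeffY]; exact congrFun hy ξ
    rw [hartleyCoeff_add, hartleyCoeff_neg, hartleyCoeff_add]
    simp only [Pi.add_apply, Pi.neg_apply, hx', hy', ellipticSymbol, add_smul, one_smul]
    abel
  have heq : SolvesElliptic u w ↔
      (-(weakDeriv (2, 0) u.toL2 + weakDeriv (0, 2) u.toL2) + u.toL2 : SquareL2 𝕜 L) = w.toL2 := by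
    rw [Lp.ext_iff]
    refine eventually_congr ?_
    filter_upwards [Lp.coeFn_add (-(weakDeriv (2, 0) u.toL2 + weakDeriv (0, 2) u.toL2)) u.toL2,
      Lp.coeFn_neg (weakDeriv (2, 0) u.toL2 + weakDeriv (0, 2) u.toL2),
      Lp.coeFn_add (weakDeriv (2, 0) u.toL2) (weakDeriv (0, 2) u.toL2)] with p h1 h2 h3
    rw [h1, Pi.add_apply, h2, Pi.neg_apply, h3, Pi.add_apply]
  rw [heq]
  constructor
  · intro h ξ
    rw [← e, h]
  · intro h
    refine ext_hartleyCoeff hL (funext fun ξ => ?_)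
    rw [e, h]

theorem eq_of_solvesElliptic (hL : 0 < L) {u v : PeriodicSobolev 𝕜 L (m + 2)}
    {w : PeriodicSobolev 𝕜 L m} (hu : SolvesElliptic u w) (hv : SolvesElliptic v w) : u = v := by
  rw [solvesElliptic_iff hL] at hu hv
  refine Subtype.ext (ext_hartleyCoeff hL (funext fun ξ => ?_))
  exact smul_right_injective 𝕜 (ellipticSymbol_pos L ξ).ne' ((hu ξ).trans (hv ξ).symm)

/-- The constant of the elliptic estimate. -/
noncomputable def ellipticConst (m : ℕ) : ℝ :=
  √((PeriodicSobolev.multiIndices (m + 2)).card * 3 ^ m)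

theorem ellipticConst_pos (m : ℕ) : 0 < ellipticConst m := by
  have : 0 < (PeriodicSobolev.multiIndices (m + 2)).card :=
    Finset.card_pos.2 ⟨(0, 0), mem_multiIndices.2 (by simp)⟩
  unfold ellipticConst
  positivity

/-- The elliptic estimate for a single frequency. -/
theorem sobolevWeight_mul_le (m : ℕ) {c d : ℤ × ℤ → 𝕜}
    (h : ∀ ξ, ellipticSymbol L ξ • c ξ = d ξ) (ξ : ℤ × ℤ) :
    sobolevWeight L (m + 2) ξ * ‖c ξ‖ ^ 2 ≤
      ellipticConst m ^ 2 * (sobolevWeight L m ξ * ‖d ξ‖ ^ 2) := by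
  rw [ellipticConst, Real.sq_sqrt (by positivity), ← h ξ, norm_smul,
    Real.norm_of_nonneg (ellipticSymbol_pos L ξ).le, mul_pow]
  calc _ ≤ ((PeriodicSobolev.multiIndices (m + 2)).card * 3 ^ m) *
        (ellipticSymbol L ξ ^ 2 * sobolevWeight L m ξ) * ‖c ξ‖ ^ 2 := by
        gcongr
        exact sobolevWeight_add_two_le m ξ
    _ = _ := by ring

theorem norm_le_of_solvesElliptic (hL : 0 < L) {u : PeriodicSobolev 𝕜 L (m + 2)}
    {w : PeriodicSobolev 𝕜 L m} (h : SolvesElliptic u w) : ‖u‖ ≤ ellipticConst m * ‖w‖ := by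
  rw [solvesElliptic_iff hL] at h
  have h2 := hasSum_le (sobolevWeight_mul_le m h) (hasSum_sobolevWeight hL u)
    ((hasSum_sobolevWeight hL w).mul_left _)
  rw [← mul_pow] at h2
  exact (abs_le_of_sq_le_sq' h2 (mul_nonneg (ellipticConst_pos m).le (norm_nonneg _))).2

theorem exists_solvesElliptic (hL : 0 < L) (w : PeriodicSobolev 𝕜 L m) :
    ∃ u : PeriodicSobolev 𝕜 L (m + 2), SolvesElliptic u w := by
  set c : ℤ × ℤ → 𝕜 := fun ξ => (ellipticSymbol L ξ)⁻¹ • hartleyCoeff L w.toL2 ξ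
  have hcw : ∀ ξ, ellipticSymbol L ξ • c ξ = hartleyCoeff L w.toL2 ξ := fun ξ =>
    smul_inv_smul₀ (ellipticSymbol_pos L ξ).ne' _
  have hsum : Summable fun ξ => ‖c ξ‖ ^ 2 := by
    refine Summable.of_nonneg_of_le (fun ξ => by positivity) (fun ξ => ?_)
      (hasSum_sq_hartleyCoeff hL w.toL2).summable
    gcongr
    have h := congrArg norm (hcw ξ)
    rw [norm_smul, Real.norm_of_nonneg (ellipticSymbol_pos L ξ).le] at h
    exact (le_mul_of_one_le_left (norm_nonneg _) (one_le_ellipticSymbol L ξ)).trans_eq h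
  obtain ⟨u, hu⟩ := exists_hartleyCoeff_eq hL hsum
  have hmem : u ∈ periodicSobolevSubmodule 𝕜 L (m + 2) := by
    refine mem_periodicSobolevSubmodule_of_summable hL ?_
    rw [hu]
    refine Summable.of_nonneg_of_le (fun ξ => ?_) (sobolevWeight_mul_le m hcw)
      ((hasSum_sobolevWeight hL w).summable.mul_left _)
    exact mul_nonneg (Finset.sum_nonneg fun α _ => derivWeight_nonneg L α ξ) (by positivity)
  refine ⟨⟨u, hmem⟩, (solvesElliptic_iff hL _ _).2 fun ξ => ?_⟩
  have hu' : hartleyCoeff L (PeriodicSobolev.toL2 (⟨u, hmem⟩ : PeriodicSobolev 𝕜 L (m + 2))) = c :=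
    hu
  rw [hu']
  exact hcw ξ

theorem toL2_add (u v : PeriodicSobolev 𝕜 L m) : (u + v).toL2 = u.toL2 + v.toL2 := rfl

theorem toL2_real_smul (a : ℝ) (u : PeriodicSobolev 𝕜 L m) : (a • u).toL2 = a • u.toL2 := rfl

theorem hartleyCoeff_real_smul (a : ℝ) (u : SquareL2 𝕜 L) (ξ : ℤ × ℤ) :
    hartleyCoeff L (a • u : SquareL2 𝕜 L) ξ = a • hartleyCoeff L u ξ := by
  rw [RCLike.real_smul_eq_coe_smul (K := 𝕜) a u, ← inner_hartleyVec, inner_smul_right,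
    inner_hartleyVec, RCLike.real_smul_eq_coe_mul]

/-- The solution operator of `-Δu + u = w` as a bounded linear map `H_P^m(Ω) → H_P^{m+2}(Ω)`. -/
noncomputable def ellipticSolution (hL : 0 < L) :
    PeriodicSobolev 𝕜 L m →L[ℝ] PeriodicSobolev 𝕜 L (m + 2) :=
  LinearMap.mkContinuous
    { toFun := fun w => (exists_solvesElliptic hL w).choose
      map_add' := fun w w' => by
        have h := (solvesElliptic_iff hL _ _).1 (exists_solvesElliptic hL w).choose_spec
        have h' := (solvesElliptic_iff hL _ _).1 (exists_solvesElliptic hL w').choose_spec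
        refine eq_of_solvesElliptic hL (exists_solvesElliptic hL (w + w')).choose_spec
          ((solvesElliptic_iff hL _ _).2 fun ξ => ?_)
        simp only [toL2_add, hartleyCoeff_add, Pi.add_apply, smul_add, h, h']
      map_smul' := fun a w => by
        have h := (solvesElliptic_iff hL _ _).1 (exists_solvesElliptic hL w).choose_spec
        refine eq_of_solvesElliptic hL (exists_solvesElliptic hL (a • w)).choose_spec
          ((solvesElliptic_iff hL _ _).2 fun ξ => ?_)
        simp only [RingHom.id_apply, toL2_real_smul, hartleyCoeff_real_smul, ← h]
        exact smul_comm _ _ _ }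
    (ellipticConst m) fun w => norm_le_of_solvesElliptic hL (exists_solvesElliptic hL w).choose_spec

theorem solvesElliptic_ellipticSolution (hL : 0 < L) (w : PeriodicSobolev 𝕜 L m) :
    SolvesElliptic (ellipticSolution hL w) w :=
  (exists_solvesElliptic hL w).choose_spec

/-! ### Weak time derivatives -/

/-- The inclusion `H_P^m(Ω) → L²(Ω)` as a continuous linear map. -/
noncomputable def toL2CLM (𝕜 : Type*) [RCLike 𝕜] (L : ℝ) (m : ℕ) :
    PeriodicSobolev 𝕜 L m →L[ℝ] SquareL2 𝕜 L :=
  LinearMap.mkContinuous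
    { toFun := PeriodicSobolev.toL2
      map_add' := toL2_add
      map_smul' := toL2_real_smul } 1 fun u => by
    rw [one_mul, PeriodicSobolev.norm_eq]
    refine Real.le_sqrt_of_sq_le ?_
    have h := Finset.single_le_sum (f := fun α => ‖weakDeriv α u.toL2‖ ^ 2)
      (fun _ _ => by positivity)
      (mem_multiIndices.2 (by simp) : ((0 : ℕ), (0 : ℕ)) ∈ PeriodicSobolev.multiIndices m)
    rwa [(isWeakDeriv_zero_index u.toL2).weakDeriv_eq] at h

/-- The equation `-Δu + u = w` survives integration in time against a test function, coefficient
by coefficient, since taking a coefficient commutes with the Bochner integral. -/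
theorem smul_hartleyCoeff_integral (hL : 0 < L) {T : ℝ} {w : ℝ → PeriodicSobolev 𝕜 L m}
    {u : ℝ → PeriodicSobolev 𝕜 L (m + 2)}
    (h : ∀ᵐ t ∂volume.restrict (Ioo 0 T), SolvesElliptic (u t) (w t))
    (hw : Integrable w (volume.restrict (Ioo 0 T)))
    (hu : Integrable u (volume.restrict (Ioo 0 T))) {φ : ℝ → ℝ} (hφ : Continuous φ)
    (hc : HasCompactSupport φ) (ξ : ℤ × ℤ) :
    ellipticSymbol L ξ • hartleyCoeff L (∫ t in Ioo 0 T, φ t • (u t).toL2 : SquareL2 𝕜 L) ξ =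
      hartleyCoeff L (∫ t in Ioo 0 T, φ t • (w t).toL2 : SquareL2 𝕜 L) ξ := by
  obtain ⟨C, hC⟩ := hc.exists_bound_of_continuous hφ
  have hint : ∀ {k : ℕ} {f : ℝ → PeriodicSobolev 𝕜 L k}, Integrable f (volume.restrict (Ioo 0 T)) →
      Integrable (fun t => φ t • (f t).toL2) (volume.restrict (Ioo 0 T)) := fun hf =>
    ((toL2CLM 𝕜 L _).integrable_comp hf).bdd_smul C hφ.aestronglyMeasurable
      (Eventually.of_forall hC)
  rw [← inner_hartleyVec, ← inner_hartleyVec, ← integral_inner (hint hu),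
    ← integral_inner (hint hw), ← integral_smul]
  refine integral_congr_ae ?_
  filter_upwards [h] with t ht
  rw [inner_hartleyVec, inner_hartleyVec, hartleyCoeff_real_smul, hartleyCoeff_real_smul,
    ← (solvesElliptic_iff hL _ _).1 ht ξ]
  exact smul_comm _ _ _

end Elliptic

theorem mainTheorem2 (m : ℕ) :
    ∃ C : ℝ, 0 < C ∧ ∀ (𝕜 : Type*) [RCLike 𝕜] (L : ℝ), 0 < L →
      -- existence, uniqueness and the estimate
      (∀ w : PeriodicSobolev 𝕜 L m,
        (∃! u : PeriodicSobolev 𝕜 L (m + 2), SolvesElliptic u w) ∧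
        ∀ u : PeriodicSobolev 𝕜 L (m + 2), SolvesElliptic u w → ‖u‖ ≤ C * ‖w‖) ∧
      -- regularity in time: continuity and classical differentiability
      (∀ (T : ℝ) (w : ℝ → PeriodicSobolev 𝕜 L m) (u : ℝ → PeriodicSobolev 𝕜 L (m + 2)),
        0 < T → (∀ t ∈ Icc 0 T, SolvesElliptic (u t) (w t)) →
        ∀ n : ℕ∞, ContDiffOn ℝ n w (Icc 0 T) → ContDiffOn ℝ n u (Icc 0 T)) ∧
      -- regularity in time: Bochner integrability
      (∀ (T : ℝ) (w : ℝ → PeriodicSobolev 𝕜 L m) (u : ℝ → PeriodicSobolev 𝕜 L (m + 2)),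
        0 < T → (∀ᵐ t ∂volume.restrict (Ioo 0 T), SolvesElliptic (u t) (w t)) →
        ∀ p : ℝ≥0∞, 1 ≤ p → MemLp w p (volume.restrict (Ioo 0 T)) →
          MemLp u p (volume.restrict (Ioo 0 T))) ∧
      -- regularity in time: weak time derivatives
      (∀ (T : ℝ) (w w' : ℝ → PeriodicSobolev 𝕜 L m) (u u' : ℝ → PeriodicSobolev 𝕜 L (m + 2)),
        0 < T → (∀ᵐ t ∂volume.restrict (Ioo 0 T), SolvesElliptic (u t) (w t)) →
        (∀ᵐ t ∂volume.restrict (Ioo 0 T), SolvesElliptic (u' t) (w' t)) →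
        ∀ p : ℝ≥0∞, 1 ≤ p → MemLp w p (volume.restrict (Ioo 0 T)) →
          MemLp w' p (volume.restrict (Ioo 0 T)) →
          IsWeakTimeDeriv T w w' → IsWeakTimeDeriv T u u') := by
  refine ⟨ellipticConst m, ellipticConst_pos m, fun 𝕜 _ L hL => ?_⟩
  have hsol : ∀ {u : PeriodicSobolev 𝕜 L (m + 2)} {w : PeriodicSobolev 𝕜 L m},
      SolvesElliptic u w → u = ellipticSolution hL w := fun h =>
    eq_of_solvesElliptic hL h (solvesElliptic_ellipticSolution hL _)
  have hmem : ∀ {T : ℝ} {w : ℝ → PeriodicSobolev 𝕜 L m} {u : ℝ → PeriodicSobolev 𝕜 L (m + 2)},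
      (∀ᵐ t ∂volume.restrict (Ioo 0 T), SolvesElliptic (u t) (w t)) →
      ∀ {p : ℝ≥0∞}, MemLp w p (volume.restrict (Ioo 0 T)) →
        MemLp u p (volume.restrict (Ioo 0 T)) := by
    intro T w u h p hw
    refine ((ellipticSolution hL).comp_memLp' hw).ae_eq ?_
    filter_upwards [h] with t ht
    exact (hsol ht).symm
  refine ⟨fun w => ⟨⟨ellipticSolution hL w, solvesElliptic_ellipticSolution hL w,
    fun u hu => hsol hu⟩, fun u hu => norm_le_of_solvesElliptic hL hu⟩, ?_, ?_, ?_⟩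
  · intro T w u _ h n hw
    exact ((ellipticSolution hL).contDiff.comp_contDiffOn hw).congr fun t ht => hsol (h t ht)
  · intro T w u _ h p _ hw
    exact hmem h hw
  · intro T w w' u u' _ h h' p hp hw hw' hder φ hφ hc hs
    have key : ∀ {v : ℝ → PeriodicSobolev 𝕜 L m} {z : ℝ → PeriodicSobolev 𝕜 L (m + 2)},
        (∀ᵐ t ∂volume.restrict (Ioo 0 T), SolvesElliptic (z t) (v t)) →
        MemLp v p (volume.restrict (Ioo 0 T)) → ∀ {ψ : ℝ → ℝ}, Continuous ψ →
        HasCompactSupport ψ → ∀ ξ,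
        ellipticSymbol L ξ • hartleyCoeff L (∫ t in Ioo 0 T, ψ t • (z t).toL2 : SquareL2 𝕜 L) ξ =
          hartleyCoeff L (∫ t in Ioo 0 T, ψ t • (v t).toL2 : SquareL2 𝕜 L) ξ :=
      fun hz hv _ hψ hψc ξ => smul_hartleyCoeff_integral hL hz (hv.integrable hp)
        ((hmem hz hv).integrable hp) hψ hψc ξ
    refine ext_hartleyCoeff hL (funext fun ξ => ?_)
    refine smul_right_injective 𝕜 (ellipticSymbol_pos L ξ).ne' ?_
    have h1 := key h hw (hφ.continuous_deriv (by simp)) hc.deriv ξ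
    have h2 := key h' hw' hφ.continuous hc ξ
    simp only [hartleyCoeff_neg, Pi.neg_apply, smul_neg]
    rw [h1, h2, hder φ hφ hc hs, hartleyCoeff_neg, Pi.neg_apply]
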